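/- Let $\mathfrak H$ be a real separable Hilbert space with complexification $\mathfrak H_{\mathbb C}$, and let $X,Y$ be independent real isonormal Gaussian processes over $\mathfrak H$, defined on one probability space $(\Omega,\mathcal F,P)$; that is, each is a centered Gaussian family with $E[X(g)X(h)]=\langle g,h\rangle$ (and likewise for $Y$). For $f,g\in\mathfrak H$ put $W(f,g)=X(f)+Y(g)$, a real isonormal process over $\mathfrak H\oplus\mathfrak H$, and for $\mathfrak h=u+iv\in\mathfrak H_{\mathbb C}$ put $$Z(\mathfrak h)=\tfrac1{\sqrt2}\big(X(u)+iX(v)+i(Y(u)+iY(v))\big).$$ Let $H_n(x)=(-1)^n e^{x^2/2}\frac{d^n}{dx^n}e^{-x^2/2}$ and let $J_{m,n}(z)=2^{m+n}(\partial^*)^m(\bar\partial^*)^n1$, where $(\partial^*\phi)(z)=-\frac{\partial\phi}{\partial\bar z}(z)+\frac z2\phi(z)$ and $(\bar\partial^*\phi)(z)=-\frac{\partial\phi}{\partial z}(z)+\frac{\bar z}2\phi(z)$. Let $\mathcal H_n(W)$ be the closed linear span in $L^2_{\mathbb R}(\Omega)$ of the variables $H_n(W(f,g))$ with $\|f\|^2+\|g\|^2=1$,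 and $\mathscr H_{k,l}(Z)$ the closed linear span in $L^2_{\mathbb C}(\Omega)$ of the variables $J_{k,l}(Z(\mathfrak h))$ with $\|\mathfrak h\|=\sqrt2$. Let $n\ge0$. Identities between random variables hold almost surely. 1. If $\|f\|^2+\|g\|^2=1$ and $\|\tilde f\|^2+\|\tilde g\|^2=1$, then for every $\theta\in\mathbb R$ $$H_n(X(f)+Y(g))+iH_n(X(\tilde f)+Y(\tilde g))=\sum_{k=0}^n d_k\big(J_{k,n-k}(Z(\mathfrak h))+iJ_{k,n-k}(Z(\tilde{\mathfrak h}))\big),$$ where $\mathfrak h=\sqrt2e^{i\theta}(f-ig)$, $\tilde{\mathfrak h}=\sqrt2e^{i\theta}(\tilde f-i\tilde g)$ and $$d_k=\frac1{2^n}\sum_{r+s=k}(-1)^s\sum_{l=0}^n\binom nl\binom lr\binom{n-l}s(\cos\theta)^l(i\sin\theta)^{n-l}.$$ 2. Let $0<\theta_n<\dots<\theta_0<\pi$ and let $M$ be the $(n+1)\times(n+1)$ matrix with entries $M_{i,l}=\binom nl(\sin\theta_i)^{n-l}(\cos\theta_i)^l$, $0\le i,l\le n$. Then $M$ is invertible,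 and for every $0\le k\le n$ and every $\mathfrak h\in\mathfrak H_{\mathbb C}$ with $\|\mathfrak h\|=\sqrt2$, $$J_{k,n-k}(Z(\mathfrak h))=\sum_{i=0}^n\tilde c_i\,H_n(X(f_i)+Y(g_i)),$$ where $f_i,g_i\in\mathfrak H$ are given by $f_i+ig_i=\frac1{\sqrt2}e^{i\theta_i}\bar{\mathfrak h}$ and $$\tilde c_i=\sum_{j=0}^n(M^{-1})_{j,i}\,i^{\,n-j}\sum_{r+s=j}\binom kr\binom{n-k}s(-1)^{n-k-s}$$ (in the factor $i^{\,n-j}$, $i$ is the imaginary unit). 3. The spaces $\mathscr H_{k,l}(Z)$, $k+l=n$, are pairwise orthogonal, and $$\mathcal H_n(W)+i\mathcal H_n(W)=\bigoplus_{k+l=n}\mathscr H_{k,l}(Z).$$ -/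

import Mathlib

open MeasureTheory ProbabilityTheory

namespace WienerChaos

/-! ### Complexification of a real Hilbert space -/

/-- The complexification of a real Hilbert space `H`: the vectors `re + i im` with
`re, im` in `H`. -/
@[ext]
structure Complexification (H : Type*) where
  /-- The real part. -/
  re : H
  /-- The imaginary part. -/
  im : H

namespace Complexification

variable {H : Type*} [NormedAddCommGroup H]

instance : Zero (Complexification H) := ⟨⟨0, 0⟩⟩
instance : Add (Complexification H) := ⟨fun x y => ⟨x.re + y.re, x.im + y.im⟩⟩
instance : Neg (Complexification H) := ⟨fun x => ⟨-x.re, -x.im⟩⟩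
instance : Sub (Complexification H) := ⟨fun x y => ⟨x.re - y.re, x.im - y.im⟩⟩

@[simp] theorem zero_re : (0 : Complexification H).re = 0 := rfl
@[simp] theorem zero_im : (0 : Complexification H).im = 0 := rfl
@[simp] theorem add_re (x y : Complexification H) : (x + y).re = x.re + y.re := rfl
@[simp] theorem add_im (x y : Complexification H) : (x + y).im = x.im + y.im := rfl
@[simp] theorem neg_re (x : Complexification H) : (-x).re = -x.re := rfl
@[simp] theorem neg_im (x : Complexification H) : (-x).im = -x.im := rfl
@[simp] theorem sub_re (x y : Complexification H) : (x - y).re = x.re - y.re := rfl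
@[simp] theorem sub_im (x y : Complexification H) : (x - y).im = x.im - y.im := rfl
variable [InnerProductSpace ℝ H]

/-- `(a + i b) (u + i v) = (a u - b v) + i (a v + b u)`. -/
instance : SMul ℂ (Complexification H) :=
  ⟨fun c x => ⟨c.re • x.re - c.im • x.im, c.re • x.im + c.im • x.re⟩⟩

@[simp] theorem smul_re (c : ℂ) (x : Complexification H) :
    (c • x).re = c.re • x.re - c.im • x.im := rfl
@[simp] theorem smul_im (c : ℂ) (x : Complexification H) :
    (c • x).im = c.re • x.im + c.im • x.re := rfl

instance : AddCommGroup (Complexification H) where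
  add_assoc x y z := by ext <;> simp [add_assoc]
  zero_add x := by ext <;> simp
  add_zero x := by ext <;> simp
  add_comm x y := by ext <;> simp [add_comm]
  neg_add_cancel x := by ext <;> simp
  sub_eq_add_neg x y := by ext <;> simp [sub_eq_add_neg]
  nsmul := nsmulRec
  zsmul := zsmulRec

instance : Module ℂ (Complexification H) where
  one_smul x := by ext <;> simp
  mul_smul a b x := by ext <;> simp <;> module
  smul_zero a := by ext <;> simp
  smul_add a x y := by ext <;> simp <;> module
  add_smul a b x := by ext <;> simp <;> module
  zero_smul x := by ext <;> simp

/-- The hermitian inner product extending that of `H`; as everywhere in Mathlib it is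
conjugate linear in the first argument:
`⟪u + i v, u' + i v'⟫ = ⟪u, u'⟫ + ⟪v, v'⟫ + i (⟪u, v'⟫ - ⟪v, u'⟫)`. -/
noncomputable instance innerCore : InnerProductSpace.Core ℂ (Complexification H) where
  inner x y := ⟨inner ℝ x.re y.re + inner ℝ x.im y.im, inner ℝ x.re y.im - inner ℝ x.im y.re⟩
  conj_inner_symm x y := by
    apply Complex.ext
    · simp [real_inner_comm]
    · simp [real_inner_comm]
  re_inner_nonneg x := add_nonneg real_inner_self_nonneg real_inner_self_nonneg
  add_left x y z := by
    apply Complex.ext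
    · simp [inner_add_left]; ring
    · simp [inner_add_left]; ring
  smul_left x y r := by
    apply Complex.ext
    · simp [inner_add_left, inner_sub_left, real_inner_smul_left]; ring
    · simp [inner_add_left, inner_sub_left, real_inner_smul_left]; ring
  definite x hx := by
    have h : inner ℝ x.re x.re + inner ℝ x.im x.im = 0 := congrArg Complex.re hx
    have h1 : 0 ≤ inner ℝ x.re x.re := real_inner_self_nonneg
    have h2 : 0 ≤ inner ℝ x.im x.im := real_inner_self_nonneg
    ext
    · exact (inner_self_eq_zero (𝕜 := ℝ)).1 (by linarith)
    · exact (inner_self_eq_zero (𝕜 := ℝ)).1 (by linarith)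

noncomputable instance : NormedAddCommGroup (Complexification H) :=
  InnerProductSpace.Core.toNormedAddCommGroup (𝕜 := ℂ)

noncomputable instance : InnerProductSpace ℂ (Complexification H) :=
  InnerProductSpace.ofCore innerCore.toCore

theorem norm_sq (x : Complexification H) : ‖x‖ ^ 2 = ‖x.re‖ ^ 2 + ‖x.im‖ ^ 2 := by
  rw [← real_inner_self_eq_norm_sq x.re, ← real_inner_self_eq_norm_sq x.im]
  exact norm_sq_eq_re_inner (𝕜 := ℂ) x

/-- Complex conjugation `u + i v ↦ u - i v`. -/
def conj (x : Complexification H) : Complexification H := ⟨x.re, -x.im⟩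

end Complexification

/-! ### Real and complex Hermite polynomials -/

/-- The real (probabilists') Hermite polynomial
`H_n(x) = (-1) ^ n e ^ (x² / 2) (d / dx) ^ n e ^ (-x² / 2)` as a function. -/
noncomputable def realHermite (n : ℕ) (x : ℝ) : ℝ := Polynomial.aeval x (Polynomial.hermite n)

/-- The Wirtinger derivative `∂φ/∂z = (∂φ/∂x - i ∂φ/∂y) / 2`. -/
noncomputable def dz (φ : ℂ → ℂ) (z : ℂ) : ℂ :=
  (fderiv ℝ φ z 1 - Complex.I * fderiv ℝ φ z Complex.I) / 2

/-- The Wirtinger derivative `∂φ/∂z̄ = (∂φ/∂x + i ∂φ/∂y) / 2`. -/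
noncomputable def dzbar (φ : ℂ → ℂ) (z : ℂ) : ℂ :=
  (fderiv ℝ φ z 1 + Complex.I * fderiv ℝ φ z Complex.I) / 2

/-- The creation operator `(∂* φ)(z) = -∂φ/∂z̄ + (z / ρ) φ(z)`. -/
noncomputable def creation (ρ : ℝ) (φ : ℂ → ℂ) (z : ℂ) : ℂ :=
  -dzbar φ z + z / (ρ : ℂ) * φ z

/-- The creation operator `(∂̄* φ)(z) = -∂φ/∂z + (z̄ / ρ) φ(z)`. -/
noncomputable def creationBar (ρ : ℝ) (φ : ℂ → ℂ) (z : ℂ) : ℂ :=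
  -dz φ z + starRingEnd ℂ z / (ρ : ℂ) * φ z

/-- The complex Hermite polynomial `J_{m,n}(z, ρ) = ρ ^ (m + n) (∂*) ^ m (∂̄*) ^ n 1`. -/
noncomputable def complexHermite (ρ : ℝ) (m n : ℕ) (z : ℂ) : ℂ :=
  (ρ : ℂ) ^ (m + n) * ((creation ρ)^[m] ((creationBar ρ)^[n] (fun _ => 1))) z

/-! ### Isonormal processes -/

section Processes

variable {Ω : Type*} [MeasurableSpace Ω]

/-- An isonormal Gaussian process over a real Hilbert space `E`: a centered Gaussian family
indexed by `E` with covariance `E[X(g) X(h)] = ⟪g, h⟫`. -/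
structure IsIsonormal {E : Type*} [NormedAddCommGroup E] [InnerProductSpace ℝ E]
    (X : E → Ω → ℝ) (P : Measure Ω) : Prop where
  gaussian : IsGaussianProcess X P
  centered : ∀ h, ∫ ω, X h ω ∂P = 0
  covariance : ∀ g h, ∫ ω, X g ω * X h ω ∂P = inner ℝ g h

variable {H : Type*} [NormedAddCommGroup H] [InnerProductSpace ℝ H]

/-- The process `W(h, f) = X(h) + Y(f)` over the Hilbert space direct sum `H ⊕ H`. -/
def directSumProcess (X Y : H → Ω → ℝ) (p : WithLp 2 (H × H)) (ω : Ω) : ℝ :=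
  X p.fst ω + Y p.snd ω

/-- `W` is an isonormal process over `H ⊕ H` when `Y` is an independent copy of `X`. -/
theorem IsIsonormal.directSum {P : Measure Ω} {X Y : H → Ω → ℝ}
    (hX : IsIsonormal X P) (hY : IsIsonormal Y P)
    (hXY : IndepFun (fun ω h => X h ω) (fun ω h => Y h ω) P) :
    IsIsonormal (directSumProcess X Y) P := by
  classical
  have hP : IsProbabilityMeasure P := hX.gaussian.isProbabilityMeasure
  have i1 : ∀ h, Integrable (X h) P := fun h => (hX.gaussian.hasGaussianLaw_eval h).integrable
  have i2 : ∀ h, Integrable (Y h) P := fun h => (hY.gaussian.hasGaussianLaw_eval h).integrable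
  have m1 : ∀ h, MemLp (X h) 2 P := fun h => (hX.gaussian.hasGaussianLaw_eval h).memLp_two
  have m2 : ∀ h, MemLp (Y h) 2 P := fun h => (hY.gaussian.hasGaussianLaw_eval h).memLp_two
  have hind : ∀ g h, ∫ ω, X g ω * Y h ω ∂P = 0 := by
    intro g h
    have : IndepFun (X g) (Y h) P :=
      hXY.comp (measurable_pi_apply g) (measurable_pi_apply h)
    rw [this.integral_fun_mul_eq_mul_integral (i1 g).aestronglyMeasurable
      (i2 h).aestronglyMeasurable, hX.centered, zero_mul]
  refine ⟨⟨fun I => ?_⟩, fun p => ?_, fun p q => ?_⟩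
  · let I1 : Finset H := I.image fun p => p.fst
    let I2 : Finset H := I.image fun p => p.snd
    have hi : IndepFun (fun ω => I1.restrict (X · ω)) (fun ω => I2.restrict (Y · ω)) P :=
      hXY.comp (Finset.measurable_restrict I1) (Finset.measurable_restrict I2)
    have hg := hi.hasGaussianLaw (hX.gaussian.hasGaussianLaw I1) (hY.gaussian.hasGaussianLaw I2)
    let L : ((I1 → ℝ) × (I2 → ℝ)) →L[ℝ] (I → ℝ) := ContinuousLinearMap.pi fun p =>
      (ContinuousLinearMap.proj (R := ℝ) (φ := fun _ : I1 => ℝ)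
        ⟨p.1.fst, Finset.mem_image_of_mem _ p.2⟩).comp (ContinuousLinearMap.fst ℝ _ _) +
      (ContinuousLinearMap.proj (R := ℝ) (φ := fun _ : I2 => ℝ)
        ⟨p.1.snd, Finset.mem_image_of_mem _ p.2⟩).comp (ContinuousLinearMap.snd ℝ _ _)
    exact hg.map_fun L
  · simp only [directSumProcess]
    rw [integral_add (i1 _) (i2 _), hX.centered, hY.centered, add_zero]
  · simp only [directSumProcess]
    have e : ∀ ω, (X p.fst ω + Y p.snd ω) * (X q.fst ω + Y q.snd ω) =
      (X p.fst ω * X q.fst ω + X p.fst ω * Y q.snd ω) +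
        (X q.fst ω * Y p.snd ω + Y p.snd ω * Y q.snd ω) := fun ω => by ring
    simp only [e]
    have j1 : Integrable (fun ω => X p.fst ω * X q.fst ω) P := (m1 _).integrable_mul (m1 _)
    have j2 : Integrable (fun ω => X p.fst ω * Y q.snd ω) P := (m1 _).integrable_mul (m2 _)
    have j3 : Integrable (fun ω => X q.fst ω * Y p.snd ω) P := (m1 _).integrable_mul (m2 _)
    have j4 : Integrable (fun ω => Y p.snd ω * Y q.snd ω) P := (m2 _).integrable_mul (m2 _)
    have j12 : Integrable (fun ω => X p.fst ω * X q.fst ω + X p.fst ω * Y q.snd ω) P := j1.add j2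
    have j34 : Integrable (fun ω => X q.fst ω * Y p.snd ω + Y p.snd ω * Y q.snd ω) P := j3.add j4
    rw [integral_add j12 j34, integral_add j1 j2, integral_add j3 j4,
      hX.covariance, hY.covariance, hind, hind, WithLp.prod_inner_apply]
    simp

/-- The complexification `X_ℂ(u + i v) = X(u) + i X(v)` of a real process. -/
noncomputable def complexifyProcess (X : H → Ω → ℝ) (h : Complexification H) (ω : Ω) : ℂ :=
  (X h.re ω : ℂ) + Complex.I * (X h.im ω : ℂ)

/-- The complex isonormal process `Z(h) = (X_ℂ(h) + i Y_ℂ(h)) / √2`. -/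
noncomputable def complexIsonormal (X Y : H → Ω → ℝ) (h : Complexification H) (ω : Ω) : ℂ :=
  (complexifyProcess X h ω + Complex.I * complexifyProcess Y h ω) / ((√2 : ℝ) : ℂ)

/-! ### Wiener-Itô chaoses -/

/-- The `n`-th Wiener-Itô chaos of a real process `X` over `E`: the closed linear span in the real
`L²(Ω)` of the random variables `H_n(X(h))`, `‖h‖ = 1`. -/
noncomputable def realChaos {E : Type*} [NormedAddCommGroup E] [InnerProductSpace ℝ E]
    (P : Measure Ω) (X : E → Ω → ℝ) (n : ℕ) : Submodule ℝ (Lp ℝ 2 P) :=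
  (Submodule.span ℝ {F : Lp ℝ 2 P | ∃ h : E, ‖h‖ = 1 ∧
    F =ᵐ[P] fun ω => realHermite n (X h ω)}).topologicalClosure

/-- The `(m, n)`-th Wiener-Itô chaos of a complex process `Z`: the closed linear span in the complex
`L²(Ω)` of the random variables `J_{m,n}(Z(h))` (with `ρ = 2`), `‖h‖ = √2`. -/
noncomputable def complexChaos (P : Measure Ω) (Z : Complexification H → Ω → ℂ) (m n : ℕ) :
    Submodule ℂ (Lp ℂ 2 P) :=
  (Submodule.span ℂ {F : Lp ℂ 2 P | ∃ h : Complexification H, ‖h‖ = √2 ∧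
    F =ᵐ[P] fun ω => complexHermite 2 m n (Z h ω)}).topologicalClosure

/-- The inclusion of the real `L²(Ω)` into the complex `L²(Ω)`. -/
noncomputable def ofRealL2 (P : Measure Ω) : Lp ℝ 2 P →L[ℝ] Lp ℂ 2 P :=
  Complex.ofRealCLM.compLpL 2 P

/-- The complexification `S + i S = {F + i G : F, G ∈ S}` of a subspace `S` of the real
`L²(Ω)`. -/
noncomputable def complexifySubmodule (P : Measure Ω) (S : Submodule ℝ (Lp ℝ 2 P)) :
    Submodule ℂ (Lp ℂ 2 P) where
  carrier := {Φ | ∃ F ∈ S, ∃ G ∈ S, Φ = ofRealL2 P F + Complex.I • ofRealL2 P G}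
  zero_mem' := ⟨0, S.zero_mem, 0, S.zero_mem, by simp⟩
  add_mem' := by
    rintro _ _ ⟨F, hF, G, hG, rfl⟩ ⟨F', hF', G', hG', rfl⟩
    refine ⟨F + F', S.add_mem hF hF', G + G', S.add_mem hG hG', ?_⟩
    simp only [map_add, smul_add]
    abel
  smul_mem' := by
    rintro c _ ⟨F, hF, G, hG, rfl⟩
    refine ⟨c.re • F - c.im • G, S.sub_mem (S.smul_mem _ hF) (S.smul_mem _ hG),
      c.re • G + c.im • F, S.add_mem (S.smul_mem _ hG) (S.smul_mem _ hF), ?_⟩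
    have hr : ∀ (r : ℝ) (f : Lp ℂ 2 P), r • f = (r : ℂ) • f := fun r f => by
      ext1
      filter_upwards [Lp.coeFn_smul r f, Lp.coeFn_smul (r : ℂ) f] with ω h1 h2
      rw [h1, h2]
      simp
    simp only [map_add, map_sub, map_smul, hr]
    generalize ofRealL2 P F = a
    generalize ofRealL2 P G = b
    nth_rewrite 1 [← Complex.re_add_im c]
    match_scalars
    · ring
    · linear_combination (c.im : ℂ) * Complex.I_mul_I

end Processes

/-! ### The coefficients -/

/-- `d_k = 2 ^ (-n) ∑_{r+s=k} (-1) ^ s ∑_{l ≤ n} C(n,l) C(l,r) C(n-l,s) cos(θ) ^ l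
(i sin(θ)) ^ (n-l)`. -/
noncomputable def dCoeff (n : ℕ) (θ : ℝ) (k : ℕ) : ℂ :=
  1 / 2 ^ n * ∑ rs ∈ Finset.HasAntidiagonal.antidiagonal k, (-1) ^ rs.2 *
    ∑ l ∈ Finset.range (n + 1), (n.choose l : ℂ) * (l.choose rs.1 : ℂ) * ((n - l).choose rs.2 : ℂ) *
      (Real.cos θ : ℂ) ^ l * (Complex.I * (Real.sin θ : ℂ)) ^ (n - l)

/-- The `(n+1) × (n+1)` matrix with rows `i` and columns `l` (both from `0` to `n`) and entries
`C(n,l) sin(θ_i) ^ (n-l) cos(θ_i) ^ l`. -/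
noncomputable def angleMatrix {n : ℕ} (θ : Fin (n + 1) → ℝ) :
    Matrix (Fin (n + 1)) (Fin (n + 1)) ℝ :=
  Matrix.of fun i l =>
    (n.choose l : ℝ) * Real.sin (θ i) ^ (n - (l : ℕ)) * Real.cos (θ i) ^ (l : ℕ)

/-- `c_i = ∑_{j ≤ n} (M⁻¹)_{j,i} I ^ (n-j) ∑_{r+s=j} C(k,r) C(n-k,s) (-1) ^ (n-k-s)`, `I² = -1`.
The terms of the inner sum with `s > n - k` vanish. -/
noncomputable def cCoeff {n : ℕ} (θ : Fin (n + 1) → ℝ) (k : ℕ) (i : Fin (n + 1)) : ℂ :=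
  ∑ j : Fin (n + 1), ((angleMatrix θ)⁻¹ j i : ℂ) * Complex.I ^ (n - (j : ℕ)) *
    ∑ rs ∈ Finset.HasAntidiagonal.antidiagonal (j : ℕ),
      (k.choose rs.1 : ℂ) * ((n - k).choose rs.2 : ℂ) * (-1) ^ (n - k - rs.2)

end WienerChaos

open WienerChaos

namespace WienerChaos

/-! ### Complex Hermite polynomials by recursion -/

/-! Everything rests on one pointwise identity: for `|a| = 1`, `2 ^ n H_n(Re (a z)) = ∑ C(n,k) a ^ k
ā ^ (n-k) J_{k,n-k}(z)` (`sum_choose_mul_hermiteRec`). Almost surely `X(f) + Y(g) = Re (e^{-iθ}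
Z(𝔥))` when `𝔥 = √2 e^{iθ} (f - i g)`, and `d_k` is `2 ^ (-n) C(n,k) e^{i(n-2k)θ}` in disguise
(`dCoeff_eq`), so the identity gives the first claim.

For the second claim the identity is inverted using `n + 1` angles. The angle matrix is a projective
Vandermonde matrix with columns rescaled by binomials, hence invertible. The binomial sums in `d_k`
and in `c_i` are coefficients of `(1 + x) ^ l (1 - x) ^ (n-l)` and `(1 + x) ^ k (x - 1) ^ (n-k)`,
and these changes of basis are inverse up to powers of `i` and the factor `2 ^ n`
(`sum_cCoeff_mul_choose`).

Orthogonality comes from phase invariance: `(Z(c𝔥), Z(c𝔥'))` has the law of `(Z(𝔥), Z(𝔥'))` for `|c|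
= 1`, while `J_{k,l}(c z) = c ^ k c̄ ^ l J_{k,l}(z)`. A suitable `c` makes the inner product equal
to its own negative. The sum of finitely many closed orthogonal subspaces is closed, so both
inclusions of the decomposition need only be checked on generators, where the first two claims
apply. -/

/-- The complex Hermite polynomials, by the recursion
`J_{m+1,n} = z J_{m,n} - ρ n J_{m,n-1}`, `J_{0,n} = z̄ ^ n`. -/
noncomputable def hermiteRec (ρ : ℝ) : ℕ → ℕ → ℂ → ℂ
  | 0, n, z => starRingEnd ℂ z ^ n
  | m + 1, n, z => z * hermiteRec ρ m n z - ρ * n * hermiteRec ρ m (n - 1) z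

theorem hermiteRec_zero (ρ : ℝ) (n : ℕ) (z : ℂ) :
    hermiteRec ρ 0 n z = starRingEnd ℂ z ^ n := rfl

theorem hermiteRec_succ_left (ρ : ℝ) (m n : ℕ) (z : ℂ) :
    hermiteRec ρ (m + 1) n z = z * hermiteRec ρ m n z - ρ * n * hermiteRec ρ m (n - 1) z := rfl

/-- Restores the symmetry between `z` and `z̄` that the definition hides. The truncated `m - 1` and
`n - 1` are harmless because their factors `m` and `n` vanish exactly when truncation occurs. -/
theorem hermiteRec_succ_right (ρ : ℝ) (m n : ℕ) (z : ℂ) :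
    hermiteRec ρ m (n + 1) z =
      starRingEnd ℂ z * hermiteRec ρ m n z - ρ * m * hermiteRec ρ (m - 1) n z := by
  induction m generalizing n with
  | zero => simp [hermiteRec_zero, pow_succ']
  | succ m ih =>
    rw [hermiteRec_succ_left, hermiteRec_succ_left, ih n, Nat.add_sub_cancel, Nat.add_sub_cancel]
    cases m with
    | zero =>
      cases n with
      | zero => simp [hermiteRec_zero]; ring
      | succ n => simp [hermiteRec_zero]; ring
    | succ m =>
      cases n with
      | zero => simp [hermiteRec_succ_left]; ring
      | succ n =>
        have h := ih n
        simp only [Nat.add_sub_cancel, hermiteRec_succ_left] at h ⊢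
        push_cast at h ⊢
        linear_combination (-(ρ * (n + 1)) : ℂ) * h

/-- The Appell property `∂_z J_{m,n} = m J_{m-1,n}`, `∂_z̄ J_{m,n} = n J_{m,n-1}`, as one real
derivative; it follows by differentiating the recursion. -/
theorem hasFDerivAt_hermiteRec (ρ : ℝ) (m n : ℕ) (z : ℂ) :
    HasFDerivAt (hermiteRec ρ m n)
      ((m * hermiteRec ρ (m - 1) n z) • ContinuousLinearMap.id ℝ ℂ +
        (n * hermiteRec ρ m (n - 1) z) • (Complex.conjCLE : ℂ →L[ℝ] ℂ)) z := by
  induction m generalizing n with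
  | zero =>
    have h : HasFDerivAt (fun z : ℂ => starRingEnd ℂ z) (Complex.conjCLE : ℂ →L[ℝ] ℂ) z :=
      Complex.conjCLE.hasFDerivAt
    have h' := h.pow n
    refine HasFDerivAt.congr_fderiv (f := hermiteRec ρ 0 n) h' ?_
    ext; simp [hermiteRec_zero]
  | succ m ih =>
    have h := (((hasFDerivAt_id (𝕜 := ℝ) z).mul (ih n)).sub
      ((ih (n - 1)).const_mul ((ρ : ℂ) * n)))
    refine HasFDerivAt.congr_fderiv (f := hermiteRec ρ (m + 1) n) h ?_
    cases m with
    | zero =>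
      cases n with
      | zero => ext; simp [hermiteRec_zero]
      | succ n =>
        ext v; simp [hermiteRec_succ_left, hermiteRec_zero]; ring
    | succ m =>
      cases n with
      | zero => ext v; simp [hermiteRec_succ_left]; ring
      | succ n =>
        ext v; simp [hermiteRec_succ_left]; ring

/-- By the Appell property, `ρ ∂*` acts on `J_{m,n}` as the right side of the recursion. The
constant `c` absorbs the powers of `1 / ρ` that accumulate under iteration. -/
theorem creation_mul_hermiteRec {ρ : ℝ} (hρ : ρ ≠ 0) (c : ℂ) (m n : ℕ) :
    creation ρ (fun z => c * hermiteRec ρ m n z) =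
      fun z => c / ρ * hermiteRec ρ (m + 1) n z := by
  have hρ' : (ρ : ℂ) ≠ 0 := by exact_mod_cast hρ
  funext z
  rw [creation, dzbar, ((hasFDerivAt_hermiteRec ρ m n z).const_mul c).fderiv,
    hermiteRec_succ_left]
  simp only [smul_apply, add_apply,
    ContinuousLinearMap.id_apply, ContinuousLinearEquiv.coe_coe, Complex.conjCLE_apply,
    smul_eq_mul, map_one, Complex.conj_I]
  field_simp
  ring_nf
  rw [Complex.I_sq]
  ring

theorem creationBar_mul_pow {ρ : ℝ} (hρ : ρ ≠ 0) (c : ℂ) (n : ℕ) :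
    creationBar ρ (fun z => c * starRingEnd ℂ z ^ n) =
      fun z => c / ρ * starRingEnd ℂ z ^ (n + 1) := by
  have hρ' : (ρ : ℂ) ≠ 0 := by exact_mod_cast hρ
  funext z
  have h : HasFDerivAt (fun z : ℂ => c * starRingEnd ℂ z ^ n) _ z :=
    (hasFDerivAt_hermiteRec ρ 0 n z).const_mul c
  rw [creationBar, dz, h.fderiv]
  simp only [smul_apply, add_apply,
    ContinuousLinearMap.id_apply, ContinuousLinearEquiv.coe_coe, Complex.conjCLE_apply,
    smul_eq_mul, map_one, Complex.conj_I]
  push_cast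
  field_simp
  ring_nf
  rw [Complex.I_sq]
  ring

theorem complexHermite_eq_hermiteRec {ρ : ℝ} (hρ : ρ ≠ 0) (m n : ℕ) (z : ℂ) :
    complexHermite ρ m n z = hermiteRec ρ m n z := by
  have hρ' : (ρ : ℂ) ≠ 0 := by exact_mod_cast hρ
  have h1 : ∀ n, (creationBar ρ)^[n] (fun _ => 1) =
      fun z => 1 / (ρ : ℂ) ^ n * starRingEnd ℂ z ^ n := by
    intro n
    induction n with
    | zero => simp
    | succ n ih =>
      rw [Function.iterate_succ_apply', ih, creationBar_mul_pow hρ]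
      funext z
      field_simp
      ring
  have h2 : ∀ m, (creation ρ)^[m] ((creationBar ρ)^[n] (fun _ => 1)) =
      fun z => 1 / (ρ : ℂ) ^ (m + n) * hermiteRec ρ m n z := by
    intro m
    induction m with
    | zero => simp [h1, hermiteRec_zero]
    | succ m ih =>
      rw [Function.iterate_succ_apply', ih, creation_mul_hermiteRec hρ]
      funext z
      field_simp
      ring
  rw [complexHermite, h2]
  field_simp

theorem continuous_hermiteRec (ρ : ℝ) (m n : ℕ) : Continuous (hermiteRec ρ m n) :=
  continuous_iff_continuousAt.2 fun z => (hasFDerivAt_hermiteRec ρ m n z).continuousAt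

/-- Gauge covariance: `J_{m,n}(c z) = c ^ m c̄ ^ n J_{m,n}(z)` for `|c| = 1`. -/
theorem hermiteRec_mul (ρ : ℝ) {c : ℂ} (hc : c * starRingEnd ℂ c = 1) (m n : ℕ) (z : ℂ) :
    hermiteRec ρ m n (c * z) = c ^ m * starRingEnd ℂ c ^ n * hermiteRec ρ m n z := by
  induction m generalizing n with
  | zero => simp [hermiteRec_zero, mul_pow]
  | succ m ih =>
    rw [hermiteRec_succ_left, hermiteRec_succ_left, ih, ih]
    -- The lower-order term has one factor `c` and one factor `c̄` too few; `c c̄ = 1` supplies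
    -- them.
    cases n with
    | zero => simp; ring
    | succ n =>
      rw [Nat.add_sub_cancel]
      push_cast
      linear_combination (-(ρ : ℂ) * (n + 1) * c ^ m * starRingEnd ℂ c ^ n *
        hermiteRec ρ m n z * (-1)) * hc

/-! ### Real Hermite polynomials of a real part -/

theorem realHermite_succ (n : ℕ) (x : ℝ) :
    realHermite (n + 1) x = x * realHermite n x - deriv (realHermite n) x := by
  have h : deriv (realHermite n) x =
      Polynomial.aeval x (Polynomial.derivative (Polynomial.hermite n)) :=
    ((Polynomial.hermite n).hasDerivAt_aeval x).deriv
  rw [h, realHermite, realHermite, Polynomial.hermite_succ]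
  simp

theorem differentiable_realHermite (n : ℕ) : Differentiable ℝ (realHermite n) :=
  (Polynomial.hermite n).differentiable_aeval

/-- The real Hermite polynomial of `Re (a z)`, `|a| = 1`, as a combination of complex Hermite
polynomials of `z`. -/
theorem sum_choose_mul_hermiteRec {a : ℂ} (ha : a * starRingEnd ℂ a = 1) (n : ℕ) (z : ℂ) :
    ∑ p ∈ Finset.HasAntidiagonal.antidiagonal n,
      (n.choose p.1 : ℂ) * (a ^ p.1 * starRingEnd ℂ a ^ p.2 * hermiteRec 2 p.1 p.2 z) =
        2 ^ n * (realHermite n (a * z).re : ℂ) := by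
  induction n generalizing z with
  | zero => simp [realHermite, hermiteRec_zero]
  | succ n ih =>
    set b := starRingEnd ℂ a with hb
    have hx : a * z + b * starRingEnd ℂ z = 2 * ((a * z).re : ℂ) := by
      rw [hb, ← map_mul, Complex.add_conj]
      push_cast; ring
    -- Moving `z` in the direction `ā` shifts `Re (a z)` at unit speed, so differentiating the
    -- induction hypothesis along it produces `H_n'`.
    have hline : ∀ t : ℝ, (a * (z + t * b)).re = (a * z).re + t := by
      intro t
      rw [mul_add, mul_left_comm, ha, Complex.add_re, mul_one, Complex.ofReal_re]
    have hd1 : HasDerivAt (fun t : ℝ => (2 : ℂ) ^ n * (realHermite n ((a * z).re + t) : ℂ))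
        (2 ^ n * ((deriv (realHermite n) (a * z).re : ℝ) : ℂ)) 0 := by
      have h : HasDerivAt (fun t : ℝ => realHermite n ((a * z).re + t))
          (deriv (realHermite n) (a * z).re) 0 := by
        simpa using (differentiable_realHermite n ((a * z).re + 0)).hasDerivAt.comp_const_add
          (a * z).re (0 : ℝ)
      exact h.ofReal_comp.const_mul _
    have hl : HasDerivAt (fun t : ℝ => z + t * b) b 0 := by
      simpa using ((Complex.ofRealCLM.hasDerivAt (x := (0 : ℝ))).mul_const b).const_add z
    have hd2 : HasDerivAt (fun t : ℝ => ∑ p ∈ Finset.HasAntidiagonal.antidiagonal n,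
        (n.choose p.1 : ℂ) * (a ^ p.1 * b ^ p.2 * hermiteRec 2 p.1 p.2 (z + t * b)))
        (∑ p ∈ Finset.HasAntidiagonal.antidiagonal n,
          (n.choose p.1 : ℂ) * (a ^ p.1 * b ^ p.2 *
            (p.1 * hermiteRec 2 (p.1 - 1) p.2 z * b +
              p.2 * hermiteRec 2 p.1 (p.2 - 1) z * a))) 0 := by
      refine HasDerivAt.fun_sum fun p _ => HasDerivAt.const_mul _ (HasDerivAt.const_mul _ ?_)
      have h := hasFDerivAt_hermiteRec 2 p.1 p.2 (z + ((0 : ℝ) : ℂ) * b)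
      have h' := h.comp_hasDerivAt (0 : ℝ) hl
      refine h'.congr_deriv ?_
      simp [hb]
    simp only [ih, hline] at hd2
    have hD := hd2.unique hd1
    have hs : ∀ p : ℕ × ℕ, p ∈ Finset.HasAntidiagonal.antidiagonal n →
        (n.choose p.2 : ℂ) = n.choose p.1 := by
      intro p hp
      rw [Finset.HasAntidiagonal.mem_antidiagonal] at hp
      rw [← hp, Nat.choose_symm_add]
    -- Pascal's rule splits the sum into terms raising either index. The two recursions then yield
    -- `2 Re (a z)` times the sum for `n`, minus twice its derivative, matching `H_{n+1} = x H_n -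
    -- H_n'`.
    rw [Finset.sum_antidiagonal_choose_succ_mul
      (fun i j => a ^ i * b ^ j * hermiteRec 2 i j z) n, ← Finset.sum_add_distrib]
    have hx2 : ∑ p ∈ Finset.HasAntidiagonal.antidiagonal n,
        ((n.choose p.1 : ℂ) * (a ^ p.1 * b ^ (p.2 + 1) * hermiteRec 2 p.1 (p.2 + 1) z) +
          (n.choose p.2 : ℂ) * (a ^ (p.1 + 1) * b ^ p.2 * hermiteRec 2 (p.1 + 1) p.2 z)) =
        (a * z + b * starRingEnd ℂ z) * (∑ p ∈ Finset.HasAntidiagonal.antidiagonal n,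
          (n.choose p.1 : ℂ) * (a ^ p.1 * b ^ p.2 * hermiteRec 2 p.1 p.2 z)) -
        2 * ∑ p ∈ Finset.HasAntidiagonal.antidiagonal n,
          (n.choose p.1 : ℂ) * (a ^ p.1 * b ^ p.2 *
            (p.1 * hermiteRec 2 (p.1 - 1) p.2 z * b +
              p.2 * hermiteRec 2 p.1 (p.2 - 1) z * a)) := by
      rw [Finset.mul_sum, Finset.mul_sum, ← Finset.sum_sub_distrib]
      refine Finset.sum_congr rfl fun p hp => ?_
      rw [hs p hp, hermiteRec_succ_left, hermiteRec_succ_right]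
      push_cast
      ring
    rw [hx2, hD, ih, hx, realHermite_succ]
    push_cast
    ring

/-! ### The coefficients -/

section Coefficients

open Polynomial

variable {R : Type*} [CommRing R]

theorem coeff_linear_pow (a b : R) (n k : ℕ) :
    ((C a * X + C b) ^ n).coeff k = n.choose k * a ^ k * b ^ (n - k) := by
  have h : ∀ i, (C a * X) ^ i * C b ^ (n - i) * (n.choose i : R[X]) =
      monomial i (n.choose i * a ^ i * b ^ (n - i)) := by
    intro i
    rw [mul_pow, ← C_pow, ← C_pow, ← C_eq_natCast, ← C_mul_X_pow_eq_monomial]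
    simp only [C_mul]
    ring
  rw [add_pow]
  simp only [h, finsetSum_coeff, coeff_monomial, Finset.sum_ite_eq', Finset.mem_range]
  split_ifs with hk
  · rfl
  · rw [Nat.choose_eq_zero_of_lt (by omega)]
    simp

theorem coeff_one_add_pow_mul_one_sub_pow (l m k : ℕ) :
    ((C 1 * X + C 1 : R[X]) ^ l * (C (-1) * X + C 1) ^ m).coeff k =
      ∑ p ∈ Finset.HasAntidiagonal.antidiagonal k,
        (l.choose p.1 : R) * (m.choose p.2 : R) * (-1) ^ p.2 := by
  rw [coeff_mul]
  refine Finset.sum_congr rfl fun p _ => ?_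
  rw [coeff_linear_pow, coeff_linear_pow]
  simp
  ring

/-- Change of basis from `c ^ l t ^ (n - l)` to `(c - t) ^ k (c + t) ^ (n - k)`. -/
theorem choose_mul_sub_pow_mul_add_pow (c t : R) (n k : ℕ) :
    (n.choose k : R) * (c - t) ^ k * (c + t) ^ (n - k) =
      ∑ l ∈ Finset.range (n + 1), (n.choose l : R) * c ^ l * t ^ (n - l) *
        ((C 1 * X + C 1 : R[X]) ^ l * (C (-1) * X + C 1) ^ (n - l)).coeff k := by
  -- Compare the coefficients of `X ^ k` in the `n`-th powers of both sides.
  have h : (C (c - t) * X + C (c + t) : R[X]) =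
      C c * (C 1 * X + C 1) + C t * (C (-1) * X + C 1) := by
    simp only [C_sub, C_add, C_neg, C_1]
    ring
  rw [← coeff_linear_pow, h, add_pow, finsetSum_coeff]
  refine Finset.sum_congr rfl fun l _ => ?_
  rw [← coeff_C_mul]
  congr 1
  simp only [mul_pow, C_mul, C_pow, C_eq_natCast]
  ring

/-- The change of basis with `c = cos θ`, `t = i sin θ`, where `c ∓ t = e^{∓iθ}`. -/
theorem dCoeff_eq (n : ℕ) (θ : ℝ) (k : ℕ) :
    dCoeff n θ k = 1 / 2 ^ n * ((n.choose k : ℂ) *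
      ((Real.cos θ : ℂ) - Complex.I * (Real.sin θ : ℂ)) ^ k *
      ((Real.cos θ : ℂ) + Complex.I * (Real.sin θ : ℂ)) ^ (n - k)) := by
  rw [dCoeff, choose_mul_sub_pow_mul_add_pow]
  simp only [coeff_one_add_pow_mul_one_sub_pow, Finset.mul_sum]
  rw [Finset.sum_comm]
  refine Finset.sum_congr rfl fun l _ => Finset.sum_congr rfl fun p _ => ?_
  ring

/-- The homogenization of `(1 + x) ^ k (x - 1) ^ m`. -/
theorem sum_choose_mul_choose_mul_pow (k m : ℕ) (y w : R) :
    ∑ l ∈ Finset.range (k + m + 1), (∑ p ∈ Finset.HasAntidiagonal.antidiagonal l,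
      (k.choose p.1 : R) * (m.choose p.2 : R) * (-1) ^ (m - p.2)) * (y ^ l * w ^ (k + m - l)) =
      (y + w) ^ k * (y - w) ^ m := by
  -- `Q` evaluated at `y` is the right side; expanding it by coefficients gives the left side.
  set Q : R[X] := (C 1 * X + C w) ^ k * (C 1 * X + C (-w)) ^ m with hQ
  have hdeg : Q.natDegree < k + m + 1 := by
    refine Nat.lt_succ_of_le (natDegree_mul_le_of_le ?_ ?_)
    · simpa using natDegree_pow_le_of_le k (natDegree_linear_le (a := (1 : R)) (b := w))
    · simpa using natDegree_pow_le_of_le m (natDegree_linear_le (a := (1 : R)) (b := -w))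
  have he : Q.eval y = (y + w) ^ k * (y - w) ^ m := by
    simp [hQ, sub_eq_add_neg]
  rw [← he, eval_eq_sum_range' hdeg]
  refine Finset.sum_congr rfl fun l _ => ?_
  rw [hQ, coeff_mul, Finset.sum_mul, Finset.sum_mul]
  refine Finset.sum_congr rfl fun p hp => ?_
  rw [Finset.HasAntidiagonal.mem_antidiagonal] at hp
  rw [coeff_linear_pow, coeff_linear_pow]
  by_cases h1 : p.1 ≤ k
  · by_cases h2 : p.2 ≤ m
    · rw [show k + m - l = (k - p.1) + (m - p.2) by omega, pow_add, neg_pow w]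
      ring
    · simp [Nat.choose_eq_zero_of_lt (not_le.1 h2)]
  · simp [Nat.choose_eq_zero_of_lt (not_le.1 h1)]

end Coefficients

/-! ### Invertibility of the angle matrix and inversion of the coefficients -/

section AngleMatrix

variable {n : ℕ} {θ : Fin (n + 1) → ℝ}

/-- Up to binomial column factors this is the projective Vandermonde determinant `∏_{i<j} sin (θ_i -
θ_j)`; all the differences lie in `(0, π)`. -/
theorem det_angleMatrix_ne_zero (hθ : StrictAnti θ) (h : ∀ i, 0 < θ i ∧ θ i < Real.pi) :
    (angleMatrix θ).det ≠ 0 := by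
  have e : angleMatrix θ = Matrix.of fun (i j : Fin (n + 1)) => (n.choose (j : ℕ) : ℝ) *
      Matrix.projVandermonde (fun i => Real.cos (θ i)) (fun i => Real.sin (θ i)) i j := by
    ext i j
    rw [angleMatrix, Matrix.of_apply, Matrix.of_apply, Matrix.projVandermonde_apply,
      Fin.val_rev, show n + 1 - ((j : ℕ) + 1) = n - (j : ℕ) by omega]
    ring
  rw [e, Matrix.det_mul_row, Matrix.det_projVandermonde]
  refine mul_ne_zero (Finset.prod_ne_zero_iff.2 fun j _ => ?_)
    (Finset.prod_ne_zero_iff.2 fun i _ => Finset.prod_ne_zero_iff.2 fun j hj => ?_)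
  · exact_mod_cast (Nat.choose_pos (Nat.lt_succ_iff.1 j.2)).ne'
  · have hij := hθ (Finset.mem_Ioi.1 hj)
    have hs := Real.sin_pos_of_pos_of_lt_pi (x := θ i - θ j) (by linarith)
      (by linarith [(h i).2, (h j).1])
    rw [Real.sin_sub] at hs
    linarith

theorem sum_cCoeff_mul_angleMatrix (hM : IsUnit (angleMatrix θ).det) (k : ℕ) (l : Fin (n + 1)) :
    ∑ i, cCoeff θ k i * (angleMatrix θ i l : ℂ) =
      Complex.I ^ (n - (l : ℕ)) * ∑ p ∈ Finset.HasAntidiagonal.antidiagonal (l : ℕ),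
        (k.choose p.1 : ℂ) * ((n - k).choose p.2 : ℂ) * (-1) ^ (n - k - p.2) := by
  have h1 : ∀ j, ∑ i, ((angleMatrix θ)⁻¹ j i : ℂ) * (angleMatrix θ i l : ℂ) =
      if j = l then 1 else 0 := by
    intro j
    have h := congrFun (congrFun (Matrix.nonsing_inv_mul (angleMatrix θ) hM) j) l
    rw [Matrix.mul_apply, Matrix.one_apply] at h
    have h' := congrArg (fun x : ℝ => (x : ℂ)) h
    push_cast at h'
    rw [h']
    split_ifs <;> simp
  simp only [cCoeff, Finset.sum_mul]
  rw [Finset.sum_comm]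
  calc _ = ∑ j : Fin (n + 1), (∑ i, ((angleMatrix θ)⁻¹ j i : ℂ) * (angleMatrix θ i l : ℂ)) *
        (Complex.I ^ (n - (j : ℕ)) * ∑ p ∈ Finset.HasAntidiagonal.antidiagonal (j : ℕ),
          (k.choose p.1 : ℂ) * ((n - k).choose p.2 : ℂ) * (-1) ^ (n - k - p.2)) := by
        refine Finset.sum_congr rfl fun j _ => ?_
        rw [Finset.sum_mul]
        exact Finset.sum_congr rfl fun i _ => by ring
    _ = _ := by simp [h1]

open Polynomial in
-- Biorthogonality of `c_i` and `d_{k'}(θ_i)`. Expanding the summand along row `i` of the angle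
-- matrix makes `M⁻¹ M` appear, leaving a coefficient of a polynomial that does not involve the
-- angles.
theorem sum_cCoeff_mul_choose (hM : IsUnit (angleMatrix θ).det) {k : ℕ} (hk : k ≤ n) (k' : ℕ) :
    ∑ i, cCoeff θ k i * ((n.choose k' : ℂ) *
      ((Real.cos (θ i) : ℂ) - Complex.I * (Real.sin (θ i) : ℂ)) ^ k' *
      ((Real.cos (θ i) : ℂ) + Complex.I * (Real.sin (θ i) : ℂ)) ^ (n - k')) =
      if k' = k then 2 ^ n else 0 := by
  set B : ℕ → ℂ := fun l => ∑ p ∈ Finset.HasAntidiagonal.antidiagonal l,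
        (k.choose p.1 : ℂ) * ((n - k).choose p.2 : ℂ) * (-1) ^ (n - k - p.2) with hB
  set Q : ℕ → ℂ[X] := fun l => (C 1 * X + C 1 : ℂ[X]) ^ l * (C (-1) * X + C 1) ^ (n - l) with hQ
  have h1 : ∀ i, (n.choose k' : ℂ) *
      ((Real.cos (θ i) : ℂ) - Complex.I * (Real.sin (θ i) : ℂ)) ^ k' *
      ((Real.cos (θ i) : ℂ) + Complex.I * (Real.sin (θ i) : ℂ)) ^ (n - k') =
      ∑ l : Fin (n + 1), (angleMatrix θ i l : ℂ) *
        (Complex.I ^ (n - (l : ℕ)) * (Q l).coeff k') := by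
    intro i
    rw [choose_mul_sub_pow_mul_add_pow, ← Fin.sum_univ_eq_sum_range (fun l => (n.choose l : ℂ) *
      (Real.cos (θ i) : ℂ) ^ l * (Complex.I * (Real.sin (θ i) : ℂ)) ^ (n - l) * (Q l).coeff k')]
    refine Finset.sum_congr rfl fun l _ => ?_
    rw [angleMatrix, Matrix.of_apply]
    push_cast
    ring
  -- The homogenized identity at `y = X + 1`, `w = X - 1`, where `y + w = 2 X` and `y - w = 2`.
  have h2 : ∑ l ∈ Finset.range (n + 1), C (B l) * ((X + 1) ^ l * (X - 1) ^ (n - l)) =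
      (C (2 ^ n) * X ^ k : ℂ[X]) := by
    have h := sum_choose_mul_choose_mul_pow k (n - k) (X + 1 : ℂ[X]) (X - 1)
    rw [Nat.add_sub_cancel' hk] at h
    have e : ∀ l, C (B l) = ∑ p ∈ Finset.HasAntidiagonal.antidiagonal l,
        (k.choose p.1 : ℂ[X]) * ((n - k).choose p.2 : ℂ[X]) * (-1) ^ (n - k - p.2) := by
      intro l
      simp [hB, map_sum]
    simp only [e]
    rw [h, show (X + 1 + (X - 1) : ℂ[X]) = 2 * X by ring,
      show (X + 1 - (X - 1) : ℂ[X]) = 2 by ring, mul_pow, mul_right_comm, ← pow_add,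
      Nat.add_sub_cancel' hk, C_pow, show C (2 : ℂ) = (2 : ℂ[X]) from map_ofNat C 2]
  calc _ = ∑ l : Fin (n + 1), (∑ i, cCoeff θ k i * (angleMatrix θ i l : ℂ)) *
        (Complex.I ^ (n - (l : ℕ)) * (Q l).coeff k') := by
        simp only [h1, Finset.mul_sum, Finset.sum_mul]
        rw [Finset.sum_comm]
        exact Finset.sum_congr rfl fun l _ => Finset.sum_congr rfl fun i _ => by ring
    _ = ∑ l : Fin (n + 1), (C (B l) * ((X + 1) ^ (l : ℕ) * (X - 1) ^ (n - (l : ℕ)))).coeff k' := by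
        refine Finset.sum_congr rfl fun l _ => ?_
        -- Two factors `I ^ (n-l)`, one from `c_i` and one from `i sin θ`, combine to the sign
        -- turning `1 - X` into `X - 1`.
        have e : (X + 1) ^ (l : ℕ) * (X - 1) ^ (n - (l : ℕ)) =
            C ((-1) ^ (n - (l : ℕ))) * Q l := by
          rw [hQ]
          simp only [C_pow, C_neg, C_1]
          rw [mul_left_comm, ← mul_pow]
          congr 2 <;> ring
        rw [sum_cCoeff_mul_angleMatrix hM, e, coeff_C_mul, coeff_C_mul,
          show (-1 : ℂ) ^ (n - (l : ℕ)) = Complex.I ^ (n - (l : ℕ)) * Complex.I ^ (n - (l : ℕ)) by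
            rw [← mul_pow, Complex.I_mul_I]]
        change Complex.I ^ (n - (l : ℕ)) * B l * _ = _
        ring
    _ = _ := by
        refine (Fin.sum_univ_eq_sum_range (fun l => (C (B l) * ((X + 1) ^ l *
          (X - 1) ^ (n - l))).coeff k') (n + 1)).trans ?_
        rw [← finsetSum_coeff, h2, coeff_C_mul_X_pow]

end AngleMatrix

/-- The real Hermite polynomial of a rotated real part in terms of complex Hermite polynomials. -/
theorem realHermite_re_exp_mul (n : ℕ) (θ : ℝ) (z : ℂ) :
    (realHermite n (Complex.exp (-(θ * Complex.I)) * z).re : ℂ) =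
      ∑ k ∈ Finset.range (n + 1), dCoeff n θ k * hermiteRec 2 k (n - k) z := by
  have ha : Complex.exp (-(θ * Complex.I)) =
      (Real.cos θ : ℂ) - Complex.I * (Real.sin θ : ℂ) := by
    rw [← neg_mul, Complex.exp_mul_I, Complex.cos_neg, Complex.sin_neg]
    push_cast
    ring
  have hb : starRingEnd ℂ (Complex.exp (-(θ * Complex.I))) =
      (Real.cos θ : ℂ) + Complex.I * (Real.sin θ : ℂ) := by
    rw [ha]
    simp [-Complex.ofReal_cos, -Complex.ofReal_sin]
  have h1 : Complex.exp (-(θ * Complex.I)) * starRingEnd ℂ (Complex.exp (-(θ * Complex.I))) =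
      1 := by
    rw [hb, ha]
    have h : (Real.cos θ : ℂ) ^ 2 + (Real.sin θ : ℂ) ^ 2 = 1 := by
      exact_mod_cast Real.cos_sq_add_sin_sq θ
    linear_combination h - (Real.sin θ : ℂ) ^ 2 * Complex.I_sq
  have h := sum_choose_mul_hermiteRec h1 n z
  rw [Finset.Nat.sum_antidiagonal_eq_sum_range_succ_mk] at h
  refine mul_left_cancel₀ (pow_ne_zero n (two_ne_zero (α := ℂ))) ?_
  rw [← h, Finset.mul_sum]
  refine Finset.sum_congr rfl fun k _ => ?_
  rw [hb, ha, dCoeff_eq]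
  field_simp

/-- Each complex Hermite polynomial is a combination of real Hermite polynomials of rotated real
parts. -/
theorem sum_cCoeff_mul_realHermite {n : ℕ} {θ : Fin (n + 1) → ℝ}
    (hM : IsUnit (angleMatrix θ).det) {k : ℕ} (hk : k ≤ n) (z : ℂ) :
    ∑ i, cCoeff θ k i * (realHermite n (Complex.exp (-(θ i * Complex.I)) * z).re : ℂ) =
      hermiteRec 2 k (n - k) z := by
  simp only [realHermite_re_exp_mul, dCoeff_eq, Finset.mul_sum]
  rw [Finset.sum_comm]
  calc _ = ∑ k' ∈ Finset.range (n + 1), 1 / 2 ^ n * (if k' = k then 2 ^ n else 0) *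
        hermiteRec 2 k' (n - k') z := by
        refine Finset.sum_congr rfl fun k' _ => ?_
        rw [← sum_cCoeff_mul_choose hM hk, Finset.mul_sum, Finset.sum_mul]
        exact Finset.sum_congr rfl fun i _ => by ring
    _ = _ := by
        simp only [mul_ite, ite_mul, mul_zero, zero_mul, Finset.sum_ite_eq', Finset.mem_range,
          Nat.lt_succ_of_le hk, if_true]
        field_simp

/-! ### Isonormal processes -/

section Isonormal

variable {Ω : Type*} [MeasurableSpace Ω] {P : Measure Ω}
  {E : Type*} [NormedAddCommGroup E] [InnerProductSpace ℝ E] {W : E → Ω → ℝ}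

theorem IsIsonormal.memLp (hW : IsIsonormal W P) (h : E) {p : ENNReal} (hp : p ≠ ⊤) :
    MemLp (W h) p P :=
  (hW.gaussian.hasGaussianLaw_eval h).memLp hp

theorem IsIsonormal.integrable_mul (hW : IsIsonormal W P) (g h : E) :
    Integrable (fun ω => W g ω * W h ω) P :=
  MemLp.integrable_mul (p := 2) (q := 2) (hW.memLp g ENNReal.ofNat_ne_top)
    (hW.memLp h ENNReal.ofNat_ne_top)

/-- Linearity of `W` is not part of the definition; this isometry yields it almost surely, and also
determines the joint laws. -/
theorem IsIsonormal.integral_sum_mul_sq (hW : IsIsonormal W P) {ι : Type*} [Fintype ι]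
    (t : ι → ℝ) (p : ι → E) :
    ∫ ω, (∑ i, t i * W (p i) ω) ^ 2 ∂P = ‖∑ i, t i • p i‖ ^ 2 := by
  have e : ∀ ω, (∑ i, t i * W (p i) ω) ^ 2 =
      ∑ i, ∑ j, t i * t j * (W (p i) ω * W (p j) ω) := by
    intro ω
    rw [sq, Finset.sum_mul_sum]
    exact Finset.sum_congr rfl fun i _ => Finset.sum_congr rfl fun j _ => by ring
  simp only [e]
  rw [integral_finsetSum _ fun i _ => integrable_finsetSum _ fun j _ =>
    (hW.integrable_mul _ _).const_mul _, ← real_inner_self_eq_norm_sq, sum_inner]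
  refine Finset.sum_congr rfl fun i _ => ?_
  rw [integral_finsetSum _ fun j _ => (hW.integrable_mul _ _).const_mul _, inner_sum]
  refine Finset.sum_congr rfl fun j _ => ?_
  rw [integral_const_mul, hW.covariance, real_inner_smul_left, real_inner_smul_right]
  ring

/-- A linear relation in `E` gives an almost sure linear relation of the process. -/
theorem IsIsonormal.sum_mul_ae_eq_zero (hW : IsIsonormal W P) {ι : Type*} [Fintype ι]
    (t : ι → ℝ) (p : ι → E) (h : ∑ i, t i • p i = 0) :
    ∀ᵐ ω ∂P, ∑ i, t i * W (p i) ω = 0 := by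
  have hm : MemLp (fun ω => ∑ i, t i * W (p i) ω) 2 P :=
    memLp_finsetSum _ fun i _ => (hW.memLp (p i) ENNReal.ofNat_ne_top).const_mul (t i)
  have h0 : ∫ ω, (∑ i, t i * W (p i) ω) ^ 2 ∂P = 0 := by
    rw [hW.integral_sum_mul_sq, h]
    simp
  rw [integral_eq_zero_iff_of_nonneg (fun ω => sq_nonneg _) hm.integrable_sq] at h0
  filter_upwards [h0] with ω hω
  exact pow_eq_zero_iff two_ne_zero |>.1 hω

theorem IsIsonormal.linear_comb_ae_eq (hW : IsIsonormal W P) (a b : ℝ) (g h : E) :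
    ∀ᵐ ω ∂P, W (a • g + b • h) ω = a * W g ω + b * W h ω := by
  have := hW.sum_mul_ae_eq_zero ![1, -a, -b] ![a • g + b • h, g, h] (by
    simp [Fin.sum_univ_three])
  filter_upwards [this] with ω hω
  simp only [Fin.sum_univ_three, Matrix.cons_val] at hω
  linarith

/-- The law of finitely many values of an isonormal process depends only on the norms of the
linear combinations of the indices. -/
theorem IsIsonormal.map_eq_map (hW : IsIsonormal W P) {ι : Type*} [Fintype ι] (p q : ι → E)
    (h : ∀ t : ι → ℝ, ‖∑ i, t i • p i‖ = ‖∑ i, t i • q i‖) :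
    P.map (fun ω => WithLp.toLp 2 fun i => W (p i) ω) =
      P.map (fun ω => WithLp.toLp 2 fun i => W (q i) ω) := by
  classical
  have hP : IsProbabilityMeasure P := hW.gaussian.isProbabilityMeasure
  have hg : ∀ p : ι → E, HasGaussianLaw (fun ω => WithLp.toLp 2 fun i => W (p i) ω) P := by
    intro p
    have h1 := (hW.gaussian.comp_right p).hasGaussianLaw Finset.univ
    let L : ({i // i ∈ Finset.univ (α := ι)} → ℝ) →L[ℝ] (ι → ℝ) := ContinuousLinearMap.pi fun i =>
      ContinuousLinearMap.proj (R := ℝ) (φ := fun _ : {i // i ∈ Finset.univ (α := ι)} => ℝ)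
        ⟨i, Finset.mem_univ i⟩
    have h2 : HasGaussianLaw (fun ω i => W (p i) ω) P := h1.map_fun L
    exact h2.toLp_pi 2
  have hin : ∀ (p : ι → E) (t : EuclideanSpace ℝ ι) (ω : Ω),
      inner ℝ t (WithLp.toLp 2 fun i => W (p i) ω) = ∑ i, t i * W (p i) ω := by
    intro p t ω
    rw [PiLp.inner_apply]
    exact Finset.sum_congr rfl fun i _ => by simp [mul_comm]
  have hmean : ∀ (p : ι → E) (t : EuclideanSpace ℝ ι),
      ∫ ω, ∑ i, t i * W (p i) ω ∂P = 0 := by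
    intro p t
    rw [integral_finsetSum _ fun i _ =>
      ((hW.memLp (p i) ENNReal.one_ne_top).integrable le_rfl).const_mul _]
    refine Finset.sum_eq_zero fun i _ => ?_
    rw [integral_const_mul, hW.centered, mul_zero]
  have hm : ∀ (p : ι → E) (t : EuclideanSpace ℝ ι), AEMeasurable (fun ω => ∑ i, t i * W (p i) ω) P :=
    fun p t => Finset.aemeasurable_fun_sum _ fun i _ =>
      (hW.gaussian.aemeasurable (p i)).const_mul _
  have := (hg p).isGaussian_map
  have := (hg q).isGaussian_map
  -- A centered Gaussian characteristic function depends only on the variances of linear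
  -- functionals, here the squared norms in `h`.
  refine Measure.ext_of_charFun (funext fun t => ?_)
  rw [(hg p).charFun_map_eq, (hg q).charFun_map_eq]
  simp only [hin, hmean]
  rw [variance_of_integral_eq_zero (hm p t) (hmean p t),
    variance_of_integral_eq_zero (hm q t) (hmean q t),
    hW.integral_sum_mul_sq (fun i => t i) p, hW.integral_sum_mul_sq (fun i => t i) q, h]

theorem IsIsonormal.memLp_realHermite (hW : IsIsonormal W P) (h : E) (n : ℕ) :
    MemLp (fun ω => realHermite n (W h ω)) 2 P := by
  have hP : IsProbabilityMeasure P := hW.gaussian.isProbabilityMeasure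
  have hpow : ∀ i : ℕ, MemLp (fun ω => W h ω ^ i) 2 P := by
    intro i
    have hm : AEStronglyMeasurable (fun ω => W h ω ^ i) P :=
      (hW.gaussian.aemeasurable h).aestronglyMeasurable.pow i
    rw [memLp_two_iff_integrable_sq_norm hm]
    have := (hW.memLp h (p := ((i * 2 : ℕ) : ENNReal)) (ENNReal.natCast_ne_top _)).integrable_norm_pow'
    simpa only [norm_pow, ← pow_mul] using this
  simp only [realHermite, Polynomial.aeval_eq_sum_range]
  refine memLp_finsetSum _ fun i _ => ?_
  simpa only [zsmul_eq_mul] using (hpow i).const_mul _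

end Isonormal

/-! ### The complex isonormal process -/

section ComplexProcess

variable {Ω : Type*} [MeasurableSpace Ω] {P : Measure Ω}
  {H : Type*} [NormedAddCommGroup H] [InnerProductSpace ℝ H] {X Y : H → Ω → ℝ}

/-- The real isometry `u + i v ↦ (u, -v)` from the complexification onto `H ⊕ H`. -/
def Complexification.toDirectSum : Complexification H →+ WithLp 2 (H × H) where
  toFun h := WithLp.toLp 2 (h.re, -h.im)
  map_zero' := by simp
  map_add' x y := by
    rw [← WithLp.toLp_add, Prod.mk_add_mk, Complexification.add_re, Complexification.add_im,
      neg_add]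

open Complexification

theorem Complexification.toDirectSum_apply {H : Type*} [NormedAddCommGroup H]
    (h : Complexification H) :
    toDirectSum h = WithLp.toLp 2 (h.re, -h.im) := rfl

theorem Complexification.toDirectSum_ofReal_smul (t : ℝ) (h : Complexification H) :
    toDirectSum ((t : ℂ) • h) = t • toDirectSum h := by
  rw [toDirectSum_apply, toDirectSum_apply, ← WithLp.toLp_smul]
  simp only [smul_re, smul_im, Complex.ofReal_re, Complex.ofReal_im, zero_smul, sub_zero,
    add_zero, Prod.smul_mk, smul_neg]

theorem Complexification.norm_toDirectSum (h : Complexification H) :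
    ‖toDirectSum h‖ = ‖h‖ := by
  rw [← sq_eq_sq₀ (norm_nonneg _) (norm_nonneg _), norm_sq, toDirectSum_apply,
    WithLp.prod_norm_sq_eq_of_L2]
  simp

/-- Writes `√2 Z(h)` through the real process `W`, so that Gaussian laws over `H ⊕ H` apply. It
holds only almost surely because `Y(-v) = -Y(v)` does. -/
theorem complexIsonormal_ae_eq (hY : IsIsonormal Y P)
    (h : Complexification H) :
    ∀ᵐ ω ∂P, complexIsonormal X Y h ω =
      ((directSumProcess X Y (toDirectSum h) ω : ℂ) +
        Complex.I * (directSumProcess X Y (toDirectSum (-Complex.I • h)) ω : ℂ)) /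
        ((√2 : ℝ) : ℂ) := by
  filter_upwards [hY.linear_comb_ae_eq (-1) 0 h.im 0] with ω hω
  have h2 : Y (-h.im) ω = -Y h.im ω := by simpa using hω
  have e : toDirectSum (-Complex.I • h) = WithLp.toLp 2 (h.im, h.re) := by
    rw [toDirectSum_apply]
    simp
  rw [e, toDirectSum_apply]
  simp only [complexIsonormal, complexifyProcess, directSumProcess, WithLp.toLp_fst,
    WithLp.toLp_snd, h2]
  congr 1
  push_cast
  linear_combination (Y h.im ω : ℂ) * Complex.I_mul_I

theorem complexIsonormal_smul_ae_eq (hX : IsIsonormal X P) (hY : IsIsonormal Y P)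
    (c : ℂ) (h : Complexification H) :
    ∀ᵐ ω ∂P, complexIsonormal X Y (c • h) ω = c * complexIsonormal X Y h ω := by
  filter_upwards [hX.linear_comb_ae_eq c.re (-c.im) h.re h.im,
    hX.linear_comb_ae_eq c.re c.im h.im h.re, hY.linear_comb_ae_eq c.re (-c.im) h.re h.im,
    hY.linear_comb_ae_eq c.re c.im h.im h.re] with ω h1 h2 h3 h4
  rw [neg_smul, ← sub_eq_add_neg] at h1 h3
  simp only [complexIsonormal, complexifyProcess, smul_re, smul_im, h1, h2, h3, h4]
  rw [← mul_div_assoc]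
  congr 1
  conv_rhs => rw [← Complex.re_add_im c]
  push_cast
  ring_nf
  simp only [Complex.I_sq, Complex.I_pow_three]
  ring

/-- The real process as a rotated real part of the complex process. -/
theorem add_ae_eq_re_mul_complexIsonormal (hX : IsIsonormal X P) (hY : IsIsonormal Y P)
    {a : ℂ} {f g : H} {h : Complexification H}
    (e : (⟨f, -g⟩ : Complexification H) = (1 / ((√2 : ℝ) : ℂ) * a) • h) :
    ∀ᵐ ω ∂P, X f ω + Y g ω = (a * complexIsonormal X Y h ω).re := by
  have hs : ((√2 : ℝ) : ℂ) ≠ 0 := by simp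
  filter_upwards [complexIsonormal_smul_ae_eq hX hY (1 / ((√2 : ℝ) : ℂ) * a) h,
    hY.linear_comb_ae_eq (-1) 0 g 0] with ω h1 h2
  have h2 : Y (-g) ω = -Y g ω := by simpa using h2
  have h3 : a * complexIsonormal X Y h ω =
      ((√2 : ℝ) : ℂ) * complexIsonormal X Y ⟨f, -g⟩ ω := by
    rw [e, h1]
    field_simp
  rw [h3, complexIsonormal, mul_div_cancel₀ _ hs]
  simp [complexifyProcess, h2]

/-- The joint law of `Z(h), Z(h')` is invariant under multiplication of `h` and `h'` by a complex
number of modulus one. -/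
theorem integral_complexIsonormal_smul (hX : IsIsonormal X P) (hY : IsIsonormal Y P)
    (hXY : IndepFun (fun ω h => X h ω) (fun ω h => Y h ω) P) {c : ℂ} (hc : ‖c‖ = 1)
    (h h' : Complexification H) {φ : ℂ → ℂ → ℂ} (hφ : Continuous fun p : ℂ × ℂ => φ p.1 p.2) :
    ∫ ω, φ (complexIsonormal X Y (c • h) ω) (complexIsonormal X Y (c • h') ω) ∂P =
      ∫ ω, φ (complexIsonormal X Y h ω) (complexIsonormal X Y h' ω) ∂P := by
  have hW := hX.directSum hY hXY
  set W := directSumProcess X Y with hWdef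
  -- Indices of the real and imaginary parts of `√2 Z(h)` and `√2 Z(h')`. Multiplication by `c`
  -- commutes with `-i` and is isometric, so it preserves the norms of all their real combinations.
  let k : Complexification H → Complexification H → Fin 4 → Complexification H :=
    fun h h' => ![h, -Complex.I • h, h', -Complex.I • h']
  have hk : ∀ i, k (c • h) (c • h') i = c • k h h' i := by
    intro i
    fin_cases i <;> simp [k, smul_comm c Complex.I]
  let ψ : EuclideanSpace ℝ (Fin 4) → ℂ := fun x =>
    φ (((x 0 : ℂ) + Complex.I * (x 1 : ℂ)) / ((√2 : ℝ) : ℂ))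
      (((x 2 : ℂ) + Complex.I * (x 3 : ℂ)) / ((√2 : ℝ) : ℂ))
  have hψ : Continuous ψ := hφ.comp (by fun_prop :
    Continuous fun x : EuclideanSpace ℝ (Fin 4) =>
      (((x 0 : ℂ) + Complex.I * (x 1 : ℂ)) / ((√2 : ℝ) : ℂ),
        ((x 2 : ℂ) + Complex.I * (x 3 : ℂ)) / ((√2 : ℝ) : ℂ)))
  have key : ∀ h h' : Complexification H,
      ∫ ω, φ (complexIsonormal X Y h ω) (complexIsonormal X Y h' ω) ∂P =
        ∫ x, ψ x ∂(P.map fun ω => WithLp.toLp 2 fun i => W (toDirectSum (k h h' i)) ω) := by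
    intro h h'
    rw [integral_map]
    · refine integral_congr_ae ?_
      filter_upwards [complexIsonormal_ae_eq hY h, complexIsonormal_ae_eq hY h'] with ω h1 h2
      rw [h1, h2]
      rfl
    · exact (WithLp.measurable_toLp 2 _).comp_aemeasurable
        (aemeasurable_pi_lambda _ fun i => hW.gaussian.aemeasurable _)
    · exact hψ.aestronglyMeasurable
  have hn : ∀ t : Fin 4 → ℝ, ‖∑ i, t i • toDirectSum (k (c • h) (c • h') i)‖ =
      ‖∑ i, t i • toDirectSum (k h h' i)‖ := by
    intro t
    simp only [← toDirectSum_ofReal_smul, ← map_sum, norm_toDirectSum, hk]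
    simp only [smul_comm _ c, ← Finset.smul_sum, norm_smul, hc, one_mul]
  rw [key, key, hW.map_eq_map _ _ hn]

/-- Rotating `h` and `h'` by a phase `c` leaves the integral unchanged but multiplies it by `c ^ (2
(m' - m))`, using `m + n = m' + n'`. -/
theorem integral_inner_complexHermite_eq_zero (hX : IsIsonormal X P) (hY : IsIsonormal Y P)
    (hXY : IndepFun (fun ω h => X h ω) (fun ω h => Y h ω) P) {m n m' n' : ℕ}
    (hmn : m + n = m' + n') (hm : m ≠ m') (h h' : Complexification H) :
    ∫ ω, inner ℂ (complexHermite 2 m n (complexIsonormal X Y h ω))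
      (complexHermite 2 m' n' (complexIsonormal X Y h' ω)) ∂P = 0 := by
  simp only [complexHermite_eq_hermiteRec two_ne_zero]
  -- The angle for which `c ^ (2 (m' - m)) = -1`; the difference may be negative.
  set α : ℂ := ((Real.pi / (2 * ((m' : ℝ) - m)) : ℝ) : ℂ) with hα
  set c : ℂ := Complex.exp (α * Complex.I) with hc
  have hcbar : starRingEnd ℂ c = Complex.exp (-(α * Complex.I)) := by
    rw [hc, ← Complex.exp_conj, map_mul, hα, Complex.conj_ofReal, Complex.conj_I, mul_neg]
  have hc1 : c * starRingEnd ℂ c = 1 := by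
    rw [hcbar, hc, ← Complex.exp_add, add_neg_cancel, Complex.exp_zero]
  have hcn : ‖c‖ = 1 := Complex.norm_exp_ofReal_mul_I _
  have hm' : (m' : ℂ) - m ≠ 0 := sub_ne_zero.2 (by exact_mod_cast hm.symm)
  have hfac : starRingEnd ℂ (c ^ m * starRingEnd ℂ c ^ n) * (c ^ m' * starRingEnd ℂ c ^ n') =
      -1 := by
    rw [map_mul, map_pow, map_pow, Complex.conj_conj, hcbar, hc]
    simp only [← Complex.exp_nat_mul, ← Complex.exp_add]
    rw [← Complex.exp_pi_mul_I]
    congr 1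
    have hn : (n : ℂ) - n' = m' - m := by
      have : (m : ℂ) + n = m' + n' := by exact_mod_cast hmn
      linear_combination this
    have hα' : α * (2 * ((m' : ℂ) - m)) = Real.pi := by
      rw [hα]
      push_cast
      field_simp
    linear_combination α * Complex.I * hn + Complex.I * hα'
  have hinv := integral_complexIsonormal_smul hX hY hXY hcn h h'
    (φ := fun z w => inner ℂ (hermiteRec 2 m n z) (hermiteRec 2 m' n' w))
    (((continuous_hermiteRec 2 m n).comp continuous_fst).inner
      ((continuous_hermiteRec 2 m' n').comp continuous_snd))
  have hmul : ∫ ω, inner ℂ (hermiteRec 2 m n (complexIsonormal X Y (c • h) ω))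
      (hermiteRec 2 m' n' (complexIsonormal X Y (c • h') ω)) ∂P =
      -1 * ∫ ω, inner ℂ (hermiteRec 2 m n (complexIsonormal X Y h ω))
        (hermiteRec 2 m' n' (complexIsonormal X Y h' ω)) ∂P := by
    rw [← integral_const_mul]
    refine integral_congr_ae ?_
    filter_upwards [complexIsonormal_smul_ae_eq hX hY c h,
      complexIsonormal_smul_ae_eq hX hY c h'] with ω h1 h2
    rw [h1, h2, hermiteRec_mul 2 hc1, hermiteRec_mul 2 hc1, ← smul_eq_mul (_ * _),
      ← smul_eq_mul (_ * _), inner_smul_left, inner_smul_right, ← mul_assoc, hfac]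
  rw [hmul] at hinv
  linear_combination (-1 / 2 : ℂ) * hinv

end ComplexProcess

/-! ### Chaos decompositions -/

section Closed

variable {Ω : Type*} [MeasurableSpace Ω] {P : Measure Ω}

theorem coeFn_ofRealL2 (F : Lp ℝ 2 P) : ofRealL2 P F =ᵐ[P] fun ω => (F ω : ℂ) :=
  Complex.ofRealCLM.coeFn_compLpL F

/-- The representatives `F`, `G` are forced to be the real and imaginary parts. Membership is thus a
preimage condition under continuous maps, which gives closedness. -/
theorem mem_complexifySubmodule {S : Submodule ℝ (Lp ℝ 2 P)} {Φ : Lp ℂ 2 P} :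
    Φ ∈ complexifySubmodule P S ↔
      Complex.reCLM.compLpL 2 P Φ ∈ S ∧ Complex.imCLM.compLpL 2 P Φ ∈ S := by
  constructor
  · rintro ⟨F, hF, G, hG, rfl⟩
    have e : ∀ᵐ ω ∂P, (ofRealL2 P F + Complex.I • ofRealL2 P G) ω =
        (F ω : ℂ) + Complex.I * (G ω : ℂ) := by
      filter_upwards [Lp.coeFn_add (ofRealL2 P F) (Complex.I • ofRealL2 P G),
        Lp.coeFn_smul Complex.I (ofRealL2 P G), coeFn_ofRealL2 F, coeFn_ofRealL2 G]
        with ω h1 h2 h3 h4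
      rw [h1, Pi.add_apply, h2, Pi.smul_apply, h3, h4, smul_eq_mul]
    have hre : Complex.reCLM.compLpL 2 P (ofRealL2 P F + Complex.I • ofRealL2 P G) = F := by
      ext1
      filter_upwards [e, Complex.reCLM.coeFn_compLpL (p := 2) (μ := P)
        (ofRealL2 P F + Complex.I • ofRealL2 P G)] with ω h1 h2
      rw [h2, h1]
      simp
    have him : Complex.imCLM.compLpL 2 P (ofRealL2 P F + Complex.I • ofRealL2 P G) = G := by
      ext1
      filter_upwards [e, Complex.imCLM.coeFn_compLpL (p := 2) (μ := P)
        (ofRealL2 P F + Complex.I • ofRealL2 P G)] with ω h1 h2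
      rw [h2, h1]
      simp
    rw [hre, him]
    exact ⟨hF, hG⟩
  · rintro ⟨h1, h2⟩
    refine ⟨_, h1, _, h2, ?_⟩
    set F := Complex.reCLM.compLpL 2 P Φ with hF
    set G := Complex.imCLM.compLpL 2 P Φ with hG
    ext1
    filter_upwards [Lp.coeFn_add (ofRealL2 P F) (Complex.I • ofRealL2 P G),
        Lp.coeFn_smul Complex.I (ofRealL2 P G), coeFn_ofRealL2 F, coeFn_ofRealL2 G,
        Complex.reCLM.coeFn_compLpL (p := 2) (μ := P) Φ,
        Complex.imCLM.coeFn_compLpL (p := 2) (μ := P) Φ]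
        with ω h1 h2 h3 h4 h5 h6
    rw [h1, Pi.add_apply, h2, Pi.smul_apply, h3, h4, hF, hG, h5, h6, smul_eq_mul, mul_comm]
    exact (Complex.re_add_im _).symm

theorem isClosed_complexifySubmodule {S : Submodule ℝ (Lp ℝ 2 P)}
    (hS : IsClosed (S : Set (Lp ℝ 2 P))) :
    IsClosed (complexifySubmodule P S : Set (Lp ℂ 2 P)) := by
  have e : (complexifySubmodule P S : Set (Lp ℂ 2 P)) =
      (Complex.reCLM.compLpL 2 P) ⁻¹' S ∩ (Complex.imCLM.compLpL 2 P) ⁻¹' S := by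
    ext Φ
    exact mem_complexifySubmodule
  rw [e]
  exact (hS.preimage (ContinuousLinearMap.continuous _)).inter
    (hS.preimage (ContinuousLinearMap.continuous _))

theorem ofRealL2_mem_complexifySubmodule {S : Submodule ℝ (Lp ℝ 2 P)} {F : Lp ℝ 2 P}
    (hF : F ∈ S) : ofRealL2 P F ∈ complexifySubmodule P S :=
  ⟨F, hF, 0, S.zero_mem, by simp⟩

theorem complexifySubmodule_topologicalClosure_span_le {s : Set (Lp ℝ 2 P)}
    {T : Submodule ℂ (Lp ℂ 2 P)} (hT : IsClosed (T : Set (Lp ℂ 2 P)))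
    (h : ∀ F ∈ s, ofRealL2 P F ∈ T) :
    complexifySubmodule P (Submodule.span ℝ s).topologicalClosure ≤ T := by
  have key : ∀ F ∈ (Submodule.span ℝ s).topologicalClosure, ofRealL2 P F ∈ T := by
    intro F hF
    refine closure_minimal (s := (Submodule.span ℝ s : Set (Lp ℝ 2 P)))
      (t := ofRealL2 P ⁻¹' T) ?_ (hT.preimage (ofRealL2 P).continuous) hF
    intro F hF
    induction hF using Submodule.span_induction with
    | mem F hF => exact h F hF
    | zero => simp
    | add F G _ _ hF hG =>
      rw [Set.mem_preimage, map_add]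
      exact T.add_mem hF hG
    | smul r F _ hF =>
      have e : ofRealL2 P (r • F) = (r : ℂ) • ofRealL2 P F := by
        ext1
        filter_upwards [coeFn_ofRealL2 (r • F), Lp.coeFn_smul r F,
          Lp.coeFn_smul (r : ℂ) (ofRealL2 P F), coeFn_ofRealL2 F] with ω h1 h2 h3 h4
        rw [h1, h2, h3, Pi.smul_apply, Pi.smul_apply, h4]
        simp
      rw [Set.mem_preimage, e]
      exact T.smul_mem _ hF
  rintro _ ⟨F, hF, G, hG, rfl⟩
  exact T.add_mem (key F hF) (T.smul_mem _ (key G hG))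

/-- The sum is the fixed-point set of the continuous operator `∑ i, P_i`, with `P_i` the orthogonal
projection onto `V i`. -/
theorem isClosed_iSup_of_orthogonalFamily {𝕜 E ι : Type*} [RCLike 𝕜] [NormedAddCommGroup E]
    [InnerProductSpace 𝕜 E] [Fintype ι] {V : ι → Submodule 𝕜 E} [∀ i, CompleteSpace (V i)]
    (hV : OrthogonalFamily 𝕜 (fun i => V i) fun i => (V i).subtypeₗᵢ) :
    IsClosed ((⨆ i, V i : Submodule 𝕜 E) : Set E) := by
  have e : ((⨆ i, V i : Submodule 𝕜 E) : Set E) = {x | ∑ i, (V i).starProjection x = x} := by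
    ext x
    refine ⟨hV.sum_projection_of_mem_iSup x, fun hx => ?_⟩
    rw [Set.mem_ofPred_eq] at hx
    rw [SetLike.mem_coe, ← hx]
    exact Submodule.sum_mem _ fun i _ =>
      Submodule.mem_iSup_of_mem i (Submodule.starProjection_apply_mem _ _)
  rw [e]
  exact isClosed_eq (by fun_prop) continuous_id

theorem inner_eq_zero_of_mem_topologicalClosure_span {𝕜 E : Type*} [RCLike 𝕜]
    [NormedAddCommGroup E] [InnerProductSpace 𝕜 E] {s t : Set E}
    (h : ∀ x ∈ s, ∀ y ∈ t, inner 𝕜 x y = 0) {x y : E}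
    (hx : x ∈ (Submodule.span 𝕜 s).topologicalClosure)
    (hy : y ∈ (Submodule.span 𝕜 t).topologicalClosure) : inner 𝕜 x y = 0 := by
  have h1 : Submodule.span 𝕜 s ⟂ Submodule.span 𝕜 t := Submodule.isOrtho_span.2 h
  rw [Submodule.isOrtho_iff_le, ← Submodule.orthogonal_closure] at h1
  exact (Submodule.topologicalClosure_minimal _ h1 (Submodule.isClosed_orthogonal _) hx) |>
    fun h => Submodule.inner_left_of_mem_orthogonal hy h

end Closed

/-! ### Orthogonality and the chaos decomposition -/

section Main

variable {Ω : Type*} [MeasurableSpace Ω] {P : Measure Ω}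
  {H : Type*} [NormedAddCommGroup H] [InnerProductSpace ℝ H] {X Y : H → Ω → ℝ}

theorem orthogonalFamily_complexChaos (hX : IsIsonormal X P) (hY : IsIsonormal Y P)
    (hXY : IndepFun (fun ω h => X h ω) (fun ω h => Y h ω) P) (n : ℕ) :
    OrthogonalFamily ℂ
      (fun p : Finset.HasAntidiagonal.antidiagonal n =>
        complexChaos P (complexIsonormal X Y) p.1.1 p.1.2)
      (fun p => (complexChaos P (complexIsonormal X Y) p.1.1 p.1.2).subtypeₗᵢ) := by
  rintro ⟨⟨m, l⟩, hp⟩ ⟨⟨m', l'⟩, hq⟩ hne ⟨x, hx⟩ ⟨y, hy⟩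
  rw [Finset.HasAntidiagonal.mem_antidiagonal] at hp hq
  dsimp only at hp hq
  have hm : m ≠ m' := by
    rintro rfl
    obtain rfl : l = l' := by omega
    exact hne rfl
  refine inner_eq_zero_of_mem_topologicalClosure_span ?_ hx hy
  rintro F ⟨h, -, hF⟩ G ⟨h', -, hG⟩
  rw [L2.inner_def, ← integral_inner_complexHermite_eq_zero hX hY hXY (hp.trans hq.symm) hm h h']
  refine integral_congr_ae ?_
  filter_upwards [hF, hG] with ω h1 h2
  rw [h1, h2]

/-- `H_n(X(f) + Y(g))` as a combination of complex Hermite polynomials of `Z`. -/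
theorem realHermite_ae_eq_sum_complexHermite (hX : IsIsonormal X P) (hY : IsIsonormal Y P)
    (n : ℕ) (θ : ℝ) {f g : H} {h : Complexification H}
    (e : h = (((√2 : ℝ) : ℂ) * Complex.exp (θ * Complex.I)) • (⟨f, -g⟩ : Complexification H)) :
    ∀ᵐ ω ∂P, (realHermite n (X f ω + Y g ω) : ℂ) = ∑ k ∈ Finset.range (n + 1),
      dCoeff n θ k * complexHermite 2 k (n - k) (complexIsonormal X Y h ω) := by
  have hs : ((√2 : ℝ) : ℂ) ≠ 0 := by simp
  have e' : (⟨f, -g⟩ : Complexification H) =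
      (1 / ((√2 : ℝ) : ℂ) * Complex.exp (-(θ * Complex.I))) • h := by
    rw [e, smul_smul, Complex.exp_neg]
    field_simp
    rw [one_smul]
  filter_upwards [add_ae_eq_re_mul_complexIsonormal hX hY e'] with ω hω
  rw [hω, realHermite_re_exp_mul]
  simp only [complexHermite_eq_hermiteRec two_ne_zero]

/-- `J_{k,n-k}(Z(h))` as a combination of real Hermite polynomials of `X(f_i) + Y(g_i)`. -/
theorem complexHermite_ae_eq_sum_realHermite (hX : IsIsonormal X P) (hY : IsIsonormal Y P)
    {n : ℕ} {θ : Fin (n + 1) → ℝ} (hM : IsUnit (angleMatrix θ).det) {k : ℕ} (hk : k ≤ n)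
    {h : Complexification H} {f g : Fin (n + 1) → H}
    (e : ∀ i, (⟨f i, g i⟩ : Complexification H) =
      (1 / ((√2 : ℝ) : ℂ) * Complex.exp (θ i * Complex.I)) • h.conj) :
    ∀ᵐ ω ∂P, complexHermite 2 k (n - k) (complexIsonormal X Y h ω) =
      ∑ i, cCoeff θ k i * (realHermite n (X (f i) ω + Y (g i) ω) : ℂ) := by
  -- Conjugating the relation for `f_i + i g_i` replaces `h̄` by `h` and `θ_i` by `-θ_i`.
  have e' : ∀ i, (⟨f i, -g i⟩ : Complexification H) =
      (1 / ((√2 : ℝ) : ℂ) * Complex.exp (-(θ i * Complex.I))) • h := by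
    intro i
    set c : ℂ := 1 / ((√2 : ℝ) : ℂ) * Complex.exp (θ i * Complex.I) with hc
    have hc' : 1 / ((√2 : ℝ) : ℂ) * Complex.exp (-(θ i * Complex.I)) = starRingEnd ℂ c := by
      rw [hc, map_mul, map_div₀, map_one, Complex.conj_ofReal, ← Complex.exp_conj, map_mul,
        Complex.conj_ofReal, Complex.conj_I, mul_neg]
    have h1 : f i = (c • h.conj).re := congrArg Complexification.re (e i)
    have h2 : g i = (c • h.conj).im := congrArg Complexification.im (e i)
    rw [hc']
    ext
    · simp [h1, Complexification.conj]
    · simp [h2, Complexification.conj, add_comm]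
  have hae : ∀ᵐ ω ∂P, ∀ i, X (f i) ω + Y (g i) ω =
      (Complex.exp (-(θ i * Complex.I)) * complexIsonormal X Y h ω).re :=
    ae_all_iff.2 fun i => add_ae_eq_re_mul_complexIsonormal hX hY (e' i)
  filter_upwards [hae] with ω hω
  simp only [hω]
  rw [sum_cCoeff_mul_realHermite hM hk, complexHermite_eq_hermiteRec two_ne_zero]

theorem exists_strictAnti_angles (n : ℕ) :
    ∃ θ : Fin (n + 1) → ℝ, StrictAnti θ ∧ ∀ i, 0 < θ i ∧ θ i < Real.pi := by
  -- The shift by `2` keeps the angle at `i = 0` strictly below `π`.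
  refine ⟨fun i => Real.pi / ((i : ℝ) + 2), fun i j hij => ?_, fun i => ⟨by positivity, ?_⟩⟩
  · have : (i : ℝ) < (j : ℝ) := by exact_mod_cast hij
    exact div_lt_div_of_pos_left Real.pi_pos (by positivity) (by linarith)
  · exact div_lt_self Real.pi_pos (by linarith [(Nat.cast_nonneg (i : ℕ) : (0 : ℝ) ≤ (i : ℕ))])

/-- For `‖h‖ = √2`, the variable `J_{k,n-k}(Z(h))` is square integrable and belongs to the
complexified real chaos. -/
theorem exists_toLp_complexHermite (hX : IsIsonormal X P) (hY : IsIsonormal Y P)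
    (hXY : IndepFun (fun ω h => X h ω) (fun ω h => Y h ω) P) {n k : ℕ} (hk : k ≤ n)
    {h : Complexification H} (hh : ‖h‖ = √2) :
    ∃ F ∈ complexifySubmodule P (realChaos P (directSumProcess X Y) n),
      F =ᵐ[P] fun ω => complexHermite 2 k (n - k) (complexIsonormal X Y h ω) := by
  obtain ⟨θ, hθ, hθ'⟩ := exists_strictAnti_angles n
  have hM : IsUnit (angleMatrix θ).det := isUnit_iff_ne_zero.2 (det_angleMatrix_ne_zero hθ hθ')
  have hW := hX.directSum hY hXY
  let c : Fin (n + 1) → ℂ := fun i => 1 / ((√2 : ℝ) : ℂ) * Complex.exp (θ i * Complex.I)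
  let p : Fin (n + 1) → WithLp 2 (H × H) := fun i =>
    WithLp.toLp 2 ((c i • h.conj).re, (c i • h.conj).im)
  have hp : ∀ i, ‖p i‖ = 1 := by
    intro i
    have hc : ‖c i‖ ^ 2 = 1 / 2 := by
      rw [norm_mul, Complex.norm_exp_ofReal_mul_I, mul_one, norm_div, norm_one,
        Complex.norm_real, Real.norm_eq_abs, div_pow, sq_abs, Real.sq_sqrt zero_le_two, one_pow]
    have hconj : ‖h.conj‖ ^ 2 = 2 := by
      rw [Complexification.norm_sq]
      change ‖h.re‖ ^ 2 + ‖-h.im‖ ^ 2 = 2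
      rw [norm_neg, ← Complexification.norm_sq, hh, Real.sq_sqrt zero_le_two]
    rw [← sq_eq_sq₀ (norm_nonneg _) zero_le_one, WithLp.prod_norm_sq_eq_of_L2]
    change ‖(c i • h.conj).re‖ ^ 2 + ‖(c i • h.conj).im‖ ^ 2 = 1 ^ 2
    rw [← Complexification.norm_sq, norm_smul, mul_pow, hc, hconj]
    norm_num
  let G : Fin (n + 1) → Lp ℝ 2 P := fun i => (hW.memLp_realHermite (p i) n).toLp _
  have hG : ∀ i, G i ∈ realChaos P (directSumProcess X Y) n := fun i =>
    Submodule.le_topologicalClosure _ (Submodule.subset_span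
      ⟨p i, hp i, (hW.memLp_realHermite (p i) n).coeFn_toLp⟩)
  refine ⟨∑ i, cCoeff θ k i • ofRealL2 P (G i), Submodule.sum_mem _ fun i _ =>
    Submodule.smul_mem _ _ (ofRealL2_mem_complexifySubmodule (hG i)), ?_⟩
  have hsum : ∀ᵐ ω ∂P, ∀ i, (cCoeff θ k i • ofRealL2 P (G i)) ω =
      cCoeff θ k i * (realHermite n (directSumProcess X Y (p i) ω) : ℂ) := by
    refine ae_all_iff.2 fun i => ?_
    filter_upwards [Lp.coeFn_smul (cCoeff θ k i) (ofRealL2 P (G i)), coeFn_ofRealL2 (G i),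
      (hW.memLp_realHermite (p i) n).coeFn_toLp] with ω h1 h2 h3
    rw [h1, Pi.smul_apply, h2, h3, smul_eq_mul]
  filter_upwards [Lp.coeFn_fun_finsetSum Finset.univ fun i => cCoeff θ k i • ofRealL2 P (G i), hsum,
    complexHermite_ae_eq_sum_realHermite hX hY hM hk (h := h)
      (f := fun i => (c i • h.conj).re) (g := fun i => (c i • h.conj).im) fun i => rfl]
    with ω h1 h2 h3
  rw [h1, h3]
  exact Finset.sum_congr rfl fun i _ => h2 i

/-- Each generator of one side is a finite combination of generators of the other. Orthogonality
enters to make the right side closed, so that it absorbs the closure on the left. -/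
theorem complexifySubmodule_realChaos_eq_iSup (hX : IsIsonormal X P) (hY : IsIsonormal Y P)
    (hXY : IndepFun (fun ω h => X h ω) (fun ω h => Y h ω) P) (n : ℕ) :
    complexifySubmodule P (realChaos P (directSumProcess X Y) n) =
      ⨆ p : Finset.HasAntidiagonal.antidiagonal n,
        complexChaos P (complexIsonormal X Y) p.1.1 p.1.2 := by
  refine le_antisymm ?_ (iSup_le ?_)
  · have : ∀ p : Finset.HasAntidiagonal.antidiagonal n,
        CompleteSpace (complexChaos P (complexIsonormal X Y) p.1.1 p.1.2) := fun p =>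
      (Submodule.isClosed_topologicalClosure _).completeSpace_coe
    refine complexifySubmodule_topologicalClosure_span_le (isClosed_iSup_of_orthogonalFamily
      (orthogonalFamily_complexChaos hX hY hXY n)) ?_
    rintro F ⟨q, hq, hF⟩
    -- Any angle would do for the expansion; zero is taken.
    set h : Complexification H := (((√2 : ℝ) : ℂ) * Complex.exp ((0 : ℝ) * Complex.I)) •
      (⟨q.fst, -q.snd⟩ : Complexification H) with hh
    have hn : ‖h‖ = √2 := by
      have h1 : ‖(⟨q.fst, -q.snd⟩ : Complexification H)‖ = 1 := by
        rw [← sq_eq_sq₀ (norm_nonneg _) zero_le_one, Complexification.norm_sq, norm_neg,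
          ← WithLp.prod_norm_sq_eq_of_L2, hq]
      rw [hh, norm_smul, h1, norm_mul, Complex.norm_exp_ofReal_mul_I, Complex.norm_real,
        Real.norm_eq_abs, abs_of_nonneg (Real.sqrt_nonneg 2), mul_one, mul_one]
    have hJ : ∀ k : Finset.range (n + 1), ∃ G : Lp ℂ 2 P,
        G =ᵐ[P] fun ω => complexHermite 2 k (n - k) (complexIsonormal X Y h ω) := fun k => by
      obtain ⟨G, -, hG⟩ := exists_toLp_complexHermite hX hY hXY
        (Nat.lt_succ_iff.1 (Finset.mem_range.1 k.2)) hn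
      exact ⟨G, hG⟩
    choose G hG using hJ
    have e : ofRealL2 P F = ∑ k : Finset.range (n + 1), dCoeff n 0 k • G k := by
      ext1
      have hsum : ∀ᵐ ω ∂P, ∀ k : Finset.range (n + 1), (dCoeff n 0 k • G k) ω =
          dCoeff n 0 k * complexHermite 2 k (n - k) (complexIsonormal X Y h ω) := by
        refine ae_all_iff.2 fun k => ?_
        filter_upwards [Lp.coeFn_smul (dCoeff n 0 k) (G k), hG k] with ω h1 h2
        rw [h1, Pi.smul_apply, h2, smul_eq_mul]
      filter_upwards [coeFn_ofRealL2 F, hF,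
        Lp.coeFn_fun_finsetSum Finset.univ fun k : Finset.range (n + 1) => dCoeff n 0 k • G k,
        hsum,
        realHermite_ae_eq_sum_complexHermite hX hY n 0 hh] with ω h1 h2 h3 h4 h5
      rw [h1, h2, h3, directSumProcess, h5, ← Finset.sum_coe_sort]
      exact Finset.sum_congr rfl fun k _ => (h4 k).symm
    rw [e]
    refine Submodule.sum_mem _ fun k _ => Submodule.smul_mem _ _ (Submodule.mem_iSup_of_mem
      ⟨(k, n - k), ?_⟩ (Submodule.le_topologicalClosure _ (Submodule.subset_span
        ⟨h, hn, hG k⟩)))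
    rw [Finset.HasAntidiagonal.mem_antidiagonal]
    exact Nat.add_sub_cancel' (Nat.lt_succ_iff.1 (Finset.mem_range.1 k.2))
  · rintro ⟨⟨k, l⟩, hp⟩
    rw [Finset.HasAntidiagonal.mem_antidiagonal] at hp
    dsimp only at hp ⊢
    refine Submodule.topologicalClosure_minimal _ (Submodule.span_le.2 ?_)
      (isClosed_complexifySubmodule (Submodule.isClosed_topologicalClosure _))
    rintro F ⟨h, hh, hF⟩
    obtain ⟨G, hG, hG'⟩ := exists_toLp_complexHermite hX hY hXY (show k ≤ n by omega) hh
    have e : F = G := by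
      ext1
      rw [show l = n - k by omega] at hF
      exact hF.trans hG'.symm
    rw [e]
    exact hG

end Main

end WienerChaos

theorem theorem3p2 {H : Type*} [NormedAddCommGroup H] [InnerProductSpace ℝ H] [CompleteSpace H]
    [TopologicalSpace.SeparableSpace H]
    {Ω : Type*} [MeasurableSpace Ω] (P : Measure Ω) [IsProbabilityMeasure P]
    (X Y : H → Ω → ℝ) (hX : IsIsonormal X P) (hY : IsIsonormal Y P)
    (hXY : IndepFun (fun ω h => X h ω) (fun ω h => Y h ω) P) (n : ℕ) :
    (∀ (θ : ℝ) (f g f' g' : H), ‖f‖ ^ 2 + ‖g‖ ^ 2 = 1 → ‖f'‖ ^ 2 + ‖g'‖ ^ 2 = 1 →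
      ∀ 𝔥 𝔥' : Complexification H,
        𝔥 = (((√2 : ℝ) : ℂ) * Complex.exp (θ * Complex.I)) • (⟨f, -g⟩ : Complexification H) →
        𝔥' = (((√2 : ℝ) : ℂ) * Complex.exp (θ * Complex.I)) • (⟨f', -g'⟩ : Complexification H) →
        (fun ω => (realHermite n (X f ω + Y g ω) : ℂ) +
            Complex.I * (realHermite n (X f' ω + Y g' ω) : ℂ)) =ᵐ[P]
          fun ω => ∑ k ∈ Finset.range (n + 1), dCoeff n θ k *
            (complexHermite 2 k (n - k) (complexIsonormal X Y 𝔥 ω) +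
              Complex.I * complexHermite 2 k (n - k) (complexIsonormal X Y 𝔥' ω))) ∧
    (∀ θ : Fin (n + 1) → ℝ, StrictAnti θ → (∀ i, 0 < θ i ∧ θ i < Real.pi) →
      IsUnit (angleMatrix θ).det ∧
      ∀ k ≤ n, ∀ 𝔥 : Complexification H, ‖𝔥‖ = √2 → ∀ f g : Fin (n + 1) → H,
        (∀ i, (⟨f i, g i⟩ : Complexification H) =
          (1 / ((√2 : ℝ) : ℂ) * Complex.exp (θ i * Complex.I)) • 𝔥.conj) →
        (fun ω => complexHermite 2 k (n - k) (complexIsonormal X Y 𝔥 ω)) =ᵐ[P]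
          fun ω => ∑ i, cCoeff θ k i * (realHermite n (X (f i) ω + Y (g i) ω) : ℂ)) ∧
    OrthogonalFamily ℂ
      (fun p : Finset.HasAntidiagonal.antidiagonal n => complexChaos P (complexIsonormal X Y) p.1.1 p.1.2)
      (fun p => (complexChaos P (complexIsonormal X Y) p.1.1 p.1.2).subtypeₗᵢ) ∧
    complexifySubmodule P (realChaos P (directSumProcess X Y) n) =
      ⨆ p : Finset.HasAntidiagonal.antidiagonal n, complexChaos P (complexIsonormal X Y) p.1.1 p.1.2 := by
  refine ⟨fun θ f g f' g' _ _ 𝔥 𝔥' h𝔥 h𝔥' => ?_, fun θ hθ hθ' => ?_,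
    orthogonalFamily_complexChaos hX hY hXY n, complexifySubmodule_realChaos_eq_iSup hX hY hXY n⟩
  · filter_upwards [realHermite_ae_eq_sum_complexHermite hX hY n θ h𝔥,
      realHermite_ae_eq_sum_complexHermite hX hY n θ h𝔥'] with ω h1 h2
    rw [h1, h2, Finset.mul_sum, ← Finset.sum_add_distrib]
    exact Finset.sum_congr rfl fun k _ => by ring
  · have hM : IsUnit (angleMatrix θ).det :=
      isUnit_iff_ne_zero.2 (det_angleMatrix_ne_zero hθ hθ')
    exact ⟨hM, fun k hk 𝔥 _ f g e => complexHermite_ae_eq_sum_realHermite hX hY hM hk e⟩
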